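/- \textbf{Setting.} Let $\kappa,\varepsilon>0$, $\lambda\ge 0$, let $\rho\in L^2(0,1)$ be real-valued with weak derivative $\rho_x$, and let $0\le m\le|\rho_x|\le M$ almost everywhere on $(0,1)$. All function spaces are over $(0,1)$ and real. Let $L=\varepsilon\Delta^2-\lambda\Delta+(\kappa+\rho_x^2)I$ with boundary conditions $v=v_{xx}=0$ at $x\in\{0,1\}$: for $f\in L^2$, $v=L^{-1}f$ is the weak solution $v\in H^2\cap H^1_0$ of $$\int_0^1\bigl(\varepsilon v_{xx}\varphi_{xx}+\lambda v_x\varphi_x+(\kappa+\rho_x^2)v\varphi\bigr)\,dx=\int_0^1 f\varphi\,dx\qquad\text{for all }\varphi\in H^2\cap H^1_0 .$$ Put $B^{-1}\theta=\rho_x L^{-1}(\rho_x\theta)$. Where $\rho_x\neq 0$, this is the inverse of $Bw=\frac1{\rho_x}\bigl(\varepsilon(\frac{w}{\rho_x})_{xxxx}-\lambda(\frac{w}{\rho_x})_{xx}+(\kappa+\rho_x^2)\frac{w}{\rho_x}\bigr)$. The Fourier transform on $(0,1)$ is the one adapted to these boundary conditions: $\hat g(\xi)=\int_0^1 g(x)\sqrt2\sin(\xi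 x)\,dx$ for $\xi\in\{\pi,2\pi,3\pi,\dots\}$. For a function $\sigma$ of $\xi$ write $\langle\hat g,\sigma\hat g\rangle=\sum_{\xi}\sigma(\xi)\,|\hat g(\xi)|^2$; $(a\Delta^2-b\Delta+cI)^{-1/2}$ is the operator on $L^2(0,1)$ with multiplier $(a\xi^4+b\xi^2+c)^{-1/2}$, for $a,b\ge0$, $c>0$. Finally $\langle\xi\rangle=(1+\xi^2)^{1/2}$. \textbf{Proposition.} The weak solution $L^{-1}f$ exists and is unique for every $f\in L^2$, and the following hold. (i) If $\rho_x\in H^2$ and $m>0$, there are constants $C_1,C_2>0$, depending only on $\rho_x,m,M$ (not on $\varepsilon,\lambda,\kappa,\theta$), such that for all $\varepsilon,\kappa>0$, $\lambda\ge0$, $\theta\in L^2$, \begin{align*} \kappa\,\bigl\|(C_1M^2\varepsilon\Delta^2-C_1M^2\lambda\Delta+(\kappa+M^2)I)^{-1/2}\theta\bigr\|_{L^2}^2 &\le\Bigl\langle\hat\theta,\frac{C_1(\varepsilon\langle\xi\rangle^4+\lambda\langle\xi\rangle^2)+\frac{\kappa}{M^2}}{C_1(\varepsilon\langle\xi\rangle^4+\lambda\langle\xi\rangle^2)+1+\frac{\kappa}{M^2}}\,\hat\theta\Bigr\rangle\\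 &\le\langle\theta,(I-B^{-1})\theta\rangle\\ &\le\Bigl\langle\hat\theta,\frac{C_2(\varepsilon\langle\xi\rangle^4+\lambda\langle\xi\rangle^2)+\frac{\kappa}{m^2}}{C_2(\varepsilon\langle\xi\rangle^4+\lambda\langle\xi\rangle^2)+1+\frac{\kappa}{m^2}}\,\hat\theta\Bigr\rangle . \end{align*} (ii) If $\rho_x\in H^1$ and $m>0$, there is a constant $C_3>0$, depending only on $\rho_x,m,M$, such that for all $\varepsilon,\kappa>0$, $\lambda\ge0$, $\theta\in L^2$, $$\kappa\,\Bigl\|\Bigl(-\tfrac{M^2\varepsilon}{C_3}\Delta+(\kappa+M^2)I\Bigr)^{-1/2}\theta\Bigr\|_{L^2}^2\le\langle\theta,(I-B^{-1})\theta\rangle\le\|\theta\|_{L^2}^2-\bigl\|(\varepsilon\Delta^2-\lambda\Delta+(\kappa+M^2)I)^{-1/2}(\theta\rho_x)\bigr\|_{L^2}^2 .$$ (iii) If $\rho_x\in L^2$ (and $m\ge0$), then for all $\varepsilon,\kappa>0$, $\lambda\ge0$, $\theta\in L^2$, $$\|\theta\|_{L^2}^2-\bigl\|(\varepsilon\Delta^2-\lambda\Delta+(\kappa+m^2)I)^{-1/2}(\theta\rho_x)\bigr\|_{L^2}^2\le\langle\theta,(I-B^{-1})\theta\rangle\le\|\theta\|_{L^2}^2-\bigl\|(\varepsilon\Delta^2-\lambda\Delta+(\kappa+M^2)I)^{-1/2}(\theta\rho_x)\bigr\|_{L^2}^2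 .$$ -/

import Mathlib

open MeasureTheory Set
open scoped ContDiff

noncomputable section

namespace HVHessian

/-- Lebesgue measure on the interval `(0,1)`. -/
abbrev unitMeasure : Measure ℝ := volume.restrict (Ioo (0 : ℝ) 1)

/-- The real Hilbert space `L²(0,1)`. -/
abbrev L2 : Type := Lp ℝ 2 unitMeasure

/-! ### Sobolev spaces on `(0,1)` -/

/-- `g` is the weak derivative of `u` on `(0,1)`. -/
def HasWeakDeriv (u g : ℝ → ℝ) : Prop :=
  ∀ φ : ℝ → ℝ, ContDiff ℝ ∞ φ → HasCompactSupport φ → tsupport φ ⊆ Ioo (0 : ℝ) 1 →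
    ∫ x in Ioo (0 : ℝ) 1, u x * deriv φ x = -∫ x in Ioo (0 : ℝ) 1, g x * φ x

/-- `u ∈ H¹(0,1)`. -/
def MemH1 (u : ℝ → ℝ) : Prop :=
  MemLp u 2 unitMeasure ∧ ∃ u₁ : ℝ → ℝ, MemLp u₁ 2 unitMeasure ∧ HasWeakDeriv u u₁

/-- `u ∈ H²(0,1)`. -/
def MemH2 (u : ℝ → ℝ) : Prop :=
  MemLp u 2 unitMeasure ∧ ∃ u₁ : ℝ → ℝ, MemH1 u₁ ∧ HasWeakDeriv u u₁

/-- `v` is the continuous representative of an element of `H²(0,1) ∩ H¹₀(0,1)`, with first and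
second weak derivatives `v₁` and `v₂`. -/
structure MemH2H10 (v v₁ v₂ : ℝ → ℝ) : Prop where
  continuousOn : ContinuousOn v (Icc 0 1)
  left : v 0 = 0
  right : v 1 = 0
  memLp₁ : MemLp v₁ 2 unitMeasure
  memLp₂ : MemLp v₂ 2 unitMeasure
  weakDeriv₁ : HasWeakDeriv v v₁
  weakDeriv₂ : HasWeakDeriv v₁ v₂

/-! ### The operators `L` and `B⁻¹`, and the Hessian form -/

/-- `v` is the weak solution of `ε v'''' - lam v'' + (κ + r²) v = f` on `(0,1)` with boundary
conditions `v = v'' = 0` at `0` and `1` (the second one is the natural boundary condition). -/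
def IsWeakSol (ε lam κ : ℝ) (r f v : ℝ → ℝ) : Prop :=
  ∃ v₁ v₂ : ℝ → ℝ, MemH2H10 v v₁ v₂ ∧
    ∀ φ φ₁ φ₂ : ℝ → ℝ, MemH2H10 φ φ₁ φ₂ →
      ε * (∫ x in Ioo (0 : ℝ) 1, v₂ x * φ₂ x) + lam * (∫ x in Ioo (0 : ℝ) 1, v₁ x * φ₁ x)
        + (∫ x in Ioo (0 : ℝ) 1, (κ + r x ^ 2) * v x * φ x)
      = ∫ x in Ioo (0 : ℝ) 1, f x * φ x

open Classical in
/-- `L⁻¹ f`, where `L = ε Δ² - lam Δ + (κ + r²)` with boundary conditions `v = v'' = 0`. -/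
def Linv (ε lam κ : ℝ) (r f : ℝ → ℝ) : ℝ → ℝ :=
  if h : ∃ v, IsWeakSol ε lam κ r f v then h.choose else 0

/-- `B⁻¹ θ = r L⁻¹ (r θ)`. Where `r` does not vanish, `w = B⁻¹ θ` says that `v = w / r` solves
`r⁻¹ (ε v'''' - lam v'' + (κ + r²) v) = θ`. -/
def Binv (ε lam κ : ℝ) (r θ : ℝ → ℝ) : ℝ → ℝ :=
  fun x => r x * Linv ε lam κ r (fun y => r y * θ y) x

/-- The Hessian form `⟨θ, (I - B⁻¹) θ⟩` on `L²(0,1)`. -/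
def hessianForm (ε lam κ : ℝ) (r : ℝ → ℝ) (θ : L2) : ℝ :=
  ∫ x in Ioo (0 : ℝ) 1, θ x * (θ x - Binv ε lam κ r θ x)

/-! ### Fourier analysis on `(0,1)` adapted to the boundary conditions `v = v'' = 0` -/

/-- The frequencies `π, 2π, 3π, …`. -/
def freq (k : ℕ) : ℝ := (k + 1) * Real.pi

/-- The function `√2 sin (ξ x)` with `ξ = freq k`. -/
def sineFun (k : ℕ) (x : ℝ) : ℝ := √2 * Real.sin (freq k * x)

/-- The functions `sineFun k` satisfy the boundary condition at `0`. -/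
lemma sineFun_zero (k : ℕ) : sineFun k 0 = 0 := by simp [sineFun]

/-- The functions `sineFun k` satisfy the boundary condition at `1`. -/
lemma sineFun_one (k : ℕ) : sineFun k 1 = 0 := by
  have := Real.sin_nat_mul_pi (k + 1)
  push_cast at this
  simp [sineFun, freq, this]

/-- The functions `sineFun k` are eigenfunctions of `Δ`, with eigenvalue `- (freq k)²`. -/
lemma deriv_deriv_sineFun (k : ℕ) :
    deriv (deriv (sineFun k)) = fun x => -(freq k) ^ 2 * sineFun k x := by
  have h1 : deriv (sineFun k) = fun x => √2 * (Real.cos (freq k * x) * freq k) := by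
    funext x
    have h := ((hasDerivAt_id x).const_mul (freq k)).sin.const_mul (√2)
    have h' := h.deriv
    simp only [id, mul_one] at h'
    exact h'
  rw [h1]
  funext x
  have h := (((hasDerivAt_id x).const_mul (freq k)).cos.mul_const (freq k)).const_mul (√2)
  have h' := h.deriv
  simp only [id] at h'
  rw [h']
  simp only [sineFun]
  ring

lemma memLp_sineFun (k : ℕ) : MemLp (sineFun k) 2 unitMeasure := by
  refine MemLp.of_bound (C := √2) ?_ ?_
  · exact (by unfold sineFun; fun_prop : Continuous (sineFun k)).aestronglyMeasurable
  · refine Filter.Eventually.of_forall fun x => ?_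
    rw [sineFun, norm_mul, Real.norm_of_nonneg (Real.sqrt_nonneg 2)]
    exact mul_le_of_le_one_right (Real.sqrt_nonneg 2) (Real.abs_sin_le_one _)

/-- The normalized eigenfunction `√2 sin (ξ x)`, `ξ = freq k`, as an element of `L²(0,1)`. -/
def sineMode (k : ℕ) : L2 := (memLp_sineFun k).toLp (sineFun k)

/-- The Fourier (sine) coefficient of `g` at the frequency `freq k`. -/
def sineCoeff (g : ℝ → ℝ) (k : ℕ) : ℝ := ∫ x in Ioo (0 : ℝ) 1, g x * sineFun k x

/-- The quadratic form `⟨ĝ, σ(ξ) ĝ⟩` of the Fourier multiplier `σ`. -/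
def multiplierForm (σ : ℝ → ℝ) (g : ℝ → ℝ) : ℝ :=
  ∑' k : ℕ, σ (freq k) * sineCoeff g k ^ 2

/-- The Fourier multiplier operator with symbol `σ`, applied to `g`. -/
def multiplierOp (σ : ℝ → ℝ) (g : ℝ → ℝ) : L2 :=
  ∑' k : ℕ, (σ (freq k) * sineCoeff g k) • sineMode k

/-- `(a Δ² - b Δ + c I)^(-1/2) g` in `L²(0,1)`, by the functional calculus of `-Δ` with the
boundary conditions `v = 0` (and `v'' = 0` for `Δ²`) at `0` and `1`. -/
def invSqrtOp (a b c : ℝ) (g : ℝ → ℝ) : L2 :=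
  multiplierOp (fun ξ => (a * ξ ^ 4 + b * ξ ^ 2 + c) ^ (-(1 / 2) : ℝ)) g

/-- The Japanese bracket `⟨ξ⟩ = (1 + ξ²)^(1/2)`. -/
def bracket (ξ : ℝ) : ℝ := √(1 + ξ ^ 2)

/-- The rational multiplier `(C e + d) / (C e + 1 + d)`, where `e = ε ⟨ξ⟩⁴ + lam ⟨ξ⟩²`. -/
def ratSymbol (C ε lam d : ℝ) (ξ : ℝ) : ℝ :=
  (C * (ε * bracket ξ ^ 4 + lam * bracket ξ ^ 2) + d) /
    (C * (ε * bracket ξ ^ 4 + lam * bracket ξ ^ 2) + 1 + d)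

lemma integral_cos_int (n : ℤ) :
    ∫ x in (0 : ℝ)..1, Real.cos (n * Real.pi * x) = if n = 0 then 1 else 0 := by
  split_ifs with h
  · simp [h]
  · have hn : (n : ℝ) * Real.pi ≠ 0 := mul_ne_zero (by exact_mod_cast h) Real.pi_ne_zero
    rw [intervalIntegral.integral_comp_mul_left (fun x => Real.cos x) hn]
    simp [Real.sin_int_mul_pi]

lemma orthonormal_sineMode : Orthonormal ℝ sineMode := by
  rw [orthonormal_iff_ite]
  intro i j
  have h1 : inner ℝ (sineMode i) (sineMode j)
      = ∫ x in Ioo (0 : ℝ) 1, sineFun j x * sineFun i x := by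
    rw [L2.inner_def]
    apply integral_congr_ae
    filter_upwards [(memLp_sineFun i).coeFn_toLp, (memLp_sineFun j).coeFn_toLp] with x hi hj
    simp only [sineMode, hi, hj]
    rfl
  rw [h1, ← integral_Ioc_eq_integral_Ioo, ← intervalIntegral.integral_of_le zero_le_one]
  have h2 : ∀ x : ℝ, sineFun j x * sineFun i x
      = Real.cos (((i : ℤ) - j : ℤ) * Real.pi * x)
        - Real.cos (((i : ℤ) + j + 2 : ℤ) * Real.pi * x) := by
    intro x
    have e1 : (((i : ℤ) - j : ℤ) : ℝ) * Real.pi * x = freq i * x - freq j * x := by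
      simp only [freq]; push_cast; ring
    have e2 : (((i : ℤ) + j + 2 : ℤ) : ℝ) * Real.pi * x = freq i * x + freq j * x := by
      simp only [freq]; push_cast; ring
    rw [e1, e2, Real.cos_sub, Real.cos_add, sineFun, sineFun]
    have := Real.mul_self_sqrt (show (0 : ℝ) ≤ 2 by norm_num)
    linear_combination (Real.sin (freq i * x) * Real.sin (freq j * x)) * this
  simp only [h2]
  rw [intervalIntegral.integral_sub
    (Continuous.intervalIntegrable (by fun_prop) _ _)
    (Continuous.intervalIntegrable (by fun_prop) _ _), integral_cos_int, integral_cos_int]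
  have h3 : ((i : ℤ) + j + 2) ≠ 0 := by omega
  rw [if_neg h3, sub_zero]
  by_cases h : i = j
  · simp [h]
  · rw [if_neg h, if_neg (by omega)]

/-- Fourier coefficients of square-integrable functions are square-summable, so that
`multiplierForm` and `multiplierOp` are convergent sums for bounded symbols. -/
lemma summable_sineCoeff_sq {g : ℝ → ℝ} (hg : MemLp g 2 unitMeasure) :
    Summable fun k => sineCoeff g k ^ 2 := by
  have h := orthonormal_sineMode.inner_products_summable (hg.toLp g)
  refine h.congr fun k => ?_
  have : inner ℝ (sineMode k) (hg.toLp g) = sineCoeff g k := by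
    rw [L2.inner_def, sineCoeff]
    apply integral_congr_ae
    filter_upwards [(memLp_sineFun k).coeFn_toLp, hg.coeFn_toLp] with x h1 h2
    simp only [sineMode, h1, h2]
    rfl
  rw [this, Real.norm_eq_abs, sq_abs]

end HVHessian

end

/-!
Write `v = L⁻¹ (r θ)` for the weight `r = ρx`. Since `v` is the weak solution of a symmetric
coercive problem, completing the square gives the variational formula
`⟨θ, (I - B⁻¹) θ⟩ = min (‖θ - r v‖² + ε ‖v''‖² + lam ‖v'‖² + κ ‖v‖²)`, the minimum being taken over
`v ∈ H² ∩ H¹₀` (`hessianForm_le`, `exists_hessianForm_eq`, `energyFunctional_eq`). All bounds follow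
by comparing this functional with functionals that are diagonal in the sine basis, which can be
minimized one frequency at a time.

* If only `m ≤ |r| ≤ M` is known, the term `‖r v‖²` is replaced by `m² ‖v‖²` or `M² ‖v‖²`; the
  operator `L` then has constant coefficients (`sub_norm_invSqrtOp_sq_le_hessianForm`,
  `hessianForm_le_sub_norm_invSqrtOp_sq`).
* If `r ∈ H²` is bounded away from zero, both `r` and `1 / r` multiply `H² ∩ H¹₀` into itself,
  boundedly in `‖v''‖` and in `‖v'‖` (`exists_dirichletSolFun_eq_mul`). In terms of `w = r v` the
  functional is then comparable to `‖θ - w‖² + ∑ s(ξ) |ŵ(ξ)|²`, whose minimum is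
  `∑ s / (s + 1) |θ̂|²` (`exists_multiplierForm_le_hessianForm`,
  `exists_hessianForm_le_multiplierForm`).
* The lower bound for `r ∈ H¹` holds for any constant, since its symbol is at most `κ / (κ + M²)`,
  which the terms `‖θ - r v‖² + κ ‖v‖²` alone dominate
  (`kappa_mul_norm_invSqrtOp_sq_le_hessianForm`).

The space `H² ∩ H¹₀` is parametrized by `g = v'' ∈ L²`: the Dirichlet problem `v'' = g` has bounded
solution operators `g ↦ v` and `g ↦ v'` on `L²`, and every element of `H² ∩ H¹₀` arises in this way
(`MemH2H10.eq_dirichlet`), which rests on the lemma of du Bois-Reymond. The weak problem thus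
becomes a Lax-Milgram problem on `L²` itself, and the sines diagonalize `g ↦ v`, so that `‖v'‖²` and
`‖v''‖²` are weighted sums of squared sine coefficients of `v`. Completeness of the
sines comes from that of the Fourier basis on `(-1,1)`, by odd extension.
-/

noncomputable section

namespace HVHessian

/-! ### The sine basis of `L²(0,1)` -/

instance : IsProbabilityMeasure unitMeasure := ⟨by simp [unitMeasure]⟩

lemma inner_eq_integral (f g : L2) :
    inner ℝ f g = ∫ x in Ioo (0 : ℝ) 1, f x * g x := by
  rw [L2.inner_def]
  exact integral_congr_ae (Filter.Eventually.of_forall fun x => mul_comm _ _)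

lemma integral_Ioo_eq_intervalIntegral (f : ℝ → ℝ) :
    ∫ x in Ioo (0 : ℝ) 1, f x = ∫ x in (0 : ℝ)..1, f x := by
  rw [← integral_Ioc_eq_integral_Ioo, ← intervalIntegral.integral_of_le zero_le_one]

lemma sineCoeff_congr {f g : ℝ → ℝ} (h : f =ᵐ[unitMeasure] g) (k : ℕ) :
    sineCoeff f k = sineCoeff g k := by
  apply integral_congr_ae
  filter_upwards [h] with x hx
  rw [hx]

lemma inner_sineMode (g : L2) (k : ℕ) : inner ℝ (sineMode k) g = sineCoeff g k := by
  rw [inner_eq_integral, sineCoeff]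
  apply integral_congr_ae
  filter_upwards [(memLp_sineFun k).coeFn_toLp] with x hx
  rw [sineMode, hx, mul_comm]

/-- Only the zero function is orthogonal to all sines: its odd extension to `(-1,1)` has
vanishing Fourier coefficients. -/
lemma eq_zero_of_sineCoeff_eq_zero (g : L2) (h : ∀ k, sineCoeff g k = 0) : g = 0 := by
  set G : ℝ → ℝ := (Ioo (0 : ℝ) 1).indicator g with hG
  have hGm : MemLp G 2 volume := (memLp_indicator_iff_restrict measurableSet_Ioo).2 (Lp.memLp g)
  have hGn : MemLp (fun x => G (-x)) 2 volume :=
    hGm.comp_measurePreserving (Measure.measurePreserving_neg volume)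
  set F : ℝ → ℂ := fun x => ((G x - G (-x) : ℝ) : ℂ) with hF
  have hFm : MemLp F 2 (volume.restrict (Ioc (-1 : ℝ) 1)) :=
    ((hGm.sub hGn).restrict _).ofReal
  have hGi : IntervalIntegrable G volume (-1) 1 := by
    rw [intervalIntegrable_iff_integrableOn_Ioc_of_le (by norm_num)]
    exact (hGm.restrict _).integrable (by norm_num)
  have hsin : ∀ n : ℤ, ∫ x in (-1 : ℝ)..1, G x * Real.sin (n * Real.pi * x) = 0 := by
    have key : ∀ c : ℝ, ∫ x in (-1 : ℝ)..1, G x * Real.sin (c * x)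
        = ∫ x in Ioo (0 : ℝ) 1, g x * Real.sin (c * x) := by
      intro c
      rw [intervalIntegral.integral_of_le (by norm_num)]
      have : (fun x => G x * Real.sin (c * x))
          = (Ioo (0 : ℝ) 1).indicator (fun x => g x * Real.sin (c * x)) := by
        funext x
        by_cases hx : x ∈ Ioo (0 : ℝ) 1 <;> simp [hG, hx]
      rw [this, setIntegral_indicator measurableSet_Ioo]
      congr 2
      ext x
      simp only [mem_inter_iff, mem_Ioc, mem_Ioo]
      constructor
      · exact fun h => h.2
      · exact fun h => ⟨⟨by linarith [h.1], h.2.le⟩, h⟩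
    have pos : ∀ k : ℕ, ∫ x in Ioo (0 : ℝ) 1, g x * Real.sin (freq k * x) = 0 := by
      intro k
      have hk := h k
      simp only [sineCoeff, sineFun] at hk
      have : ∀ x, g x * (√2 * Real.sin (freq k * x))
          = √2 * (g x * Real.sin (freq k * x)) := fun x => by ring
      simp only [this, integral_const_mul] at hk
      exact (mul_eq_zero.1 hk).resolve_left (by positivity)
    intro n
    rw [key]
    rcases lt_trichotomy n 0 with hn | hn | hn
    · have := pos (-n - 1).toNat
      have e : freq (-n - 1).toNat = -(n * Real.pi) := by
        have : (((-n - 1).toNat : ℤ) : ℝ) = -n - 1 := by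
          rw [Int.toNat_of_nonneg (by omega)]; push_cast; ring
        rw [Int.cast_natCast] at this
        simp only [freq, this]; ring
      simp only [e, neg_mul, Real.sin_neg, mul_neg, integral_neg, neg_eq_zero] at this
      exact this
    · simp [hn]
    · have := pos (n - 1).toNat
      have e : freq (n - 1).toNat = n * Real.pi := by
        have : (((n - 1).toNat : ℤ) : ℝ) = n - 1 := by
          rw [Int.toNat_of_nonneg (by omega)]; push_cast; ring
        rw [Int.cast_natCast] at this
        simp only [freq, this]; ring
      rwa [e] at this
  -- the odd function `F` has no cosine part, and its sine part vanishes by assumption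
  have hcoeff : ∀ n : ℤ, fourierCoeffOn (show (-1 : ℝ) < 1 by norm_num) F n = 0 := by
    intro n
    rw [fourierCoeffOn_eq_integral]
    have e0 : ∀ x : ℝ, (fourier (-n) (x : AddCircle ((1 : ℝ) - -1)) : ℂ)
        = (Real.cos (n * Real.pi * x) : ℂ) - (Real.sin (n * Real.pi * x) : ℂ) * Complex.I := by
      intro x
      rw [fourier_coe_apply, show (2 * Real.pi * Complex.I * ((-n : ℤ) : ℂ) * x
        / (((1 : ℝ) - -1 : ℝ) : ℂ) : ℂ) = ((-(n * Real.pi * x) : ℝ) : ℂ) * Complex.I by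
          push_cast; ring, Complex.exp_mul_I, ← Complex.ofReal_cos, ← Complex.ofReal_sin,
          Real.cos_neg, Real.sin_neg]
      push_cast; ring
    have hc : Continuous fun x : ℝ => Real.cos (n * Real.pi * x) := by fun_prop
    have hs : Continuous fun x : ℝ => Real.sin (n * Real.pi * x) := by fun_prop
    have hGi' : IntervalIntegrable (fun x => G (-x)) volume (-1) 1 := by
      have := (IntervalIntegrable.iff_comp_neg (f := G) (a := 1) (b := -1)).1 hGi.symm
      simpa using this
    have i1 : IntervalIntegrable (fun x => (G x - G (-x)) * Real.cos (n * Real.pi * x))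
        volume (-1) 1 := (hGi.sub hGi').mul_continuousOn hc.continuousOn
    have i2 : IntervalIntegrable (fun x => (G x - G (-x)) * Real.sin (n * Real.pi * x))
        volume (-1) 1 := (hGi.sub hGi').mul_continuousOn hs.continuousOn
    have c1 : ∫ x in (-1 : ℝ)..1, (G x - G (-x)) * Real.cos (n * Real.pi * x) = 0 := by
      simp only [sub_mul]
      rw [intervalIntegral.integral_sub (hGi.mul_continuousOn hc.continuousOn)
        (hGi'.mul_continuousOn hc.continuousOn)]
      have := intervalIntegral.integral_comp_neg (a := -1) (b := 1)
        (fun x => G x * Real.cos (n * Real.pi * x))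
      simp only [mul_neg, Real.cos_neg, neg_neg] at this
      rw [this, sub_self]
    have c2 : ∫ x in (-1 : ℝ)..1, (G x - G (-x)) * Real.sin (n * Real.pi * x) = 0 := by
      simp only [sub_mul]
      rw [intervalIntegral.integral_sub (hGi.mul_continuousOn hs.continuousOn)
        (hGi'.mul_continuousOn hs.continuousOn)]
      have := intervalIntegral.integral_comp_neg (a := -1) (b := 1)
        (fun x => G x * Real.sin (n * Real.pi * x))
      simp only [mul_neg, Real.sin_neg, neg_neg, intervalIntegral.integral_neg, hsin] at this
      rw [hsin, neg_eq_zero.1 this, sub_self]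
    have e1 : ∀ x : ℝ, (fourier (-n) (x : AddCircle ((1 : ℝ) - -1)) : ℂ) • F x
        = (((G x - G (-x)) * Real.cos (n * Real.pi * x) : ℝ) : ℂ)
          - (((G x - G (-x)) * Real.sin (n * Real.pi * x) : ℝ) : ℂ) * Complex.I := by
      intro x
      rw [e0, smul_eq_mul, hF]; push_cast; ring
    simp only [e1]
    have j1 : IntervalIntegrable (fun x =>
        (((G x - G (-x)) * Real.cos (n * Real.pi * x) : ℝ) : ℂ)) volume (-1) 1 :=
      ⟨Integrable.ofReal i1.1, Integrable.ofReal i1.2⟩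
    have j2 : IntervalIntegrable (fun x =>
        (((G x - G (-x)) * Real.sin (n * Real.pi * x) : ℝ) : ℂ)) volume (-1) 1 :=
      ⟨Integrable.ofReal i2.1, Integrable.ofReal i2.2⟩
    rw [intervalIntegral.integral_sub j1 (j2.mul_const _),
      intervalIntegral.integral_mul_const, intervalIntegral.integral_ofReal,
      intervalIntegral.integral_ofReal, c1, c2]
    simp
  have hsum := tsum_sq_fourierCoeffOn (show (-1 : ℝ) < 1 by norm_num) hFm
  simp only [hcoeff, norm_zero, ne_eq, OfNat.ofNat_ne_zero, not_false_eq_true, zero_pow,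
    tsum_zero] at hsum
  have hzero : ∫ x in (-1 : ℝ)..1, ‖F x‖ ^ 2 = 0 := by
    have h2 := hsum.symm
    rw [smul_eq_mul] at h2
    exact (mul_eq_zero.1 h2).resolve_left (by norm_num)
  rw [intervalIntegral.integral_of_le (by norm_num),
    integral_eq_zero_iff_of_nonneg (fun x => by positivity)
      (by simpa using hFm.integrable_norm_pow two_ne_zero)] at hzero
  rw [Lp.eq_zero_iff_ae_eq_zero]
  have hsub : Ioo (0 : ℝ) 1 ⊆ Ioc (-1 : ℝ) 1 := fun x hx => ⟨by linarith [hx.1], hx.2.le⟩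
  have hz : ∀ᵐ x ∂unitMeasure, ‖F x‖ ^ 2 = 0 := ae_mono (Measure.restrict_mono hsub le_rfl) hzero
  filter_upwards [hz, ae_restrict_mem measurableSet_Ioo] with x hx hx1
  have hx2 : -x ∉ Ioo (0 : ℝ) 1 := fun h => by linarith [h.1, hx1.1]
  simpa [hF, hG, hx1, hx2] using hx

/-- The functions `√2 sin (kπx)`, `k ≥ 1`, as a Hilbert basis of `L²(0,1)`. -/
def sineBasis : HilbertBasis ℕ ℝ L2 :=
  HilbertBasis.mkOfOrthogonalEqBot orthonormal_sineMode <| by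
    rw [Submodule.eq_bot_iff]
    intro g hg
    apply eq_zero_of_sineCoeff_eq_zero
    intro k
    rw [← inner_sineMode]
    exact hg _ (Submodule.subset_span ⟨k, rfl⟩)

lemma sineBasis_apply (k : ℕ) : sineBasis k = sineMode k := by
  simp [sineBasis]

lemma hasSum_sineCoeff_mul (f g : L2) :
    HasSum (fun k => sineCoeff f k * sineCoeff g k) (inner ℝ f g) := by
  refine (sineBasis.hasSum_inner_mul_inner f g).congr_fun ?_
  intro k
  rw [sineBasis_apply, inner_sineMode, real_inner_comm, inner_sineMode]

lemma hasSum_sineCoeff_sq (f : L2) : HasSum (fun k => sineCoeff f k ^ 2) (‖f‖ ^ 2) := by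
  have h := hasSum_sineCoeff_mul f f
  rw [real_inner_self_eq_norm_sq] at h
  simpa only [sq] using h

lemma summable_bdd_mul_sineCoeff_sq (g : L2) {d : ℕ → ℝ} {B : ℝ} (hd : ∀ k, |d k| ≤ B) :
    Summable fun k => d k * sineCoeff g k ^ 2 := by
  refine Summable.of_norm_bounded ((hasSum_sineCoeff_sq g).summable.mul_left B) fun k => ?_
  rw [norm_mul, Real.norm_eq_abs, Real.norm_of_nonneg (sq_nonneg _)]
  exact mul_le_mul_of_nonneg_right (hd k) (sq_nonneg _)

/-- Bounded sequences act on `L²(0,1)` as diagonal operators in the sine basis. -/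
lemma exists_sineCoeff_eq (g : L2) {d : ℕ → ℝ} {B : ℝ} (hd : ∀ k, |d k| ≤ B) :
    ∃ f : L2, (∀ k, sineCoeff f k = d k * sineCoeff g k) ∧
      HasSum (fun k => (d k * sineCoeff g k) • sineMode k) f := by
  have hs : Summable fun k => ‖d k * sineCoeff g k‖ ^ (2 : ENNReal).toReal := by
    have hd2 : ∀ k, |d k ^ 2| ≤ B ^ 2 := fun k => by
      rw [abs_pow]; exact pow_le_pow_left₀ (abs_nonneg _) (hd k) 2
    refine (summable_bdd_mul_sineCoeff_sq g hd2).congr fun k => ?_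
    rw [ENNReal.toReal_ofNat, Real.rpow_two, Real.norm_eq_abs, sq_abs, mul_pow]
  let c : lp (fun _ : ℕ => ℝ) 2 := ⟨fun k => d k * sineCoeff g k, memℓp_gen hs⟩
  refine ⟨sineBasis.repr.symm c, fun k => ?_, ?_⟩
  · rw [← inner_sineMode, ← sineBasis_apply, ← sineBasis.repr_apply_apply,
      LinearIsometryEquiv.apply_symm_apply]
  · have := sineBasis.hasSum_repr_symm c
    simpa only [sineBasis_apply] using this

lemma hasSum_norm_multiplierOp_sq (σ : ℝ → ℝ) {B : ℝ} (hσ : ∀ k, |σ (freq k)| ≤ B) (g : L2) :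
    HasSum (fun k => σ (freq k) ^ 2 * sineCoeff g k ^ 2) (‖multiplierOp σ g‖ ^ 2) := by
  obtain ⟨f, hf, hfs⟩ := exists_sineCoeff_eq g hσ
  have : multiplierOp σ g = f := hfs.tsum_eq
  rw [this]
  refine (hasSum_sineCoeff_sq f).congr_fun fun k => ?_
  rw [hf, mul_pow]

lemma hasSum_norm_invSqrtOp_sq {a b c : ℝ} (ha : 0 ≤ a) (hb : 0 ≤ b) (hc : 0 < c) (g : L2) :
    HasSum (fun k => sineCoeff g k ^ 2 / (a * freq k ^ 4 + b * freq k ^ 2 + c))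
      (‖invSqrtOp a b c g‖ ^ 2) := by
  have hpos : ∀ k, c ≤ a * freq k ^ 4 + b * freq k ^ 2 + c := fun k => by
    have : 0 ≤ a * freq k ^ 4 + b * freq k ^ 2 := by positivity
    linarith
  have h := hasSum_norm_multiplierOp_sq
    (fun ξ => (a * ξ ^ 4 + b * ξ ^ 2 + c) ^ (-(1 / 2) : ℝ)) (B := c ^ (-(1 / 2) : ℝ))
    (fun k => by
      rw [abs_of_nonneg (Real.rpow_nonneg (hc.le.trans (hpos k)) _)]
      exact Real.rpow_le_rpow_of_nonpos hc (hpos k) (by norm_num)) g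
  refine h.congr_fun fun k => ?_
  have h0 := hc.trans_le (hpos k)
  have hinv : ((a * freq k ^ 4 + b * freq k ^ 2 + c) ^ (-(1 / 2) : ℝ)) ^ 2
      = (a * freq k ^ 4 + b * freq k ^ 2 + c)⁻¹ := by
    rw [← Real.rpow_mul_natCast h0.le]
    norm_num [Real.rpow_neg_one]
  rw [hinv, div_eq_inv_mul]

lemma invSqrtOp_congr {f g : ℝ → ℝ} (h : f =ᵐ[unitMeasure] g) (a b c : ℝ) :
    invSqrtOp a b c f = invSqrtOp a b c g := by
  simp only [invSqrtOp, multiplierOp, sineCoeff_congr h]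

/-! ### Primitives and weak derivatives on `(0,1)` -/

/-- `u` is, on `[0,1]`, a primitive of the integrable function `g`; equivalently, `u` is absolutely
continuous there with derivative `g`. -/
structure IsPrim (u g : ℝ → ℝ) : Prop where
  integrable : Integrable g unitMeasure
  eq_add_integral : ∀ x ∈ Icc (0 : ℝ) 1, u x = u 0 + ∫ t in (0 : ℝ)..x, g t

lemma intervalIntegrable_of_integrable {g : ℝ → ℝ} (hg : Integrable g unitMeasure) {x y : ℝ}
    (hx : x ∈ Icc (0 : ℝ) 1) (hy : y ∈ Icc (0 : ℝ) 1) : IntervalIntegrable g volume x y := by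
  have h : IntervalIntegrable g volume 0 1 := by
    rw [intervalIntegrable_iff_integrableOn_Ioc_of_le zero_le_one,
      integrableOn_Ioc_iff_integrableOn_Ioo]
    exact hg
  refine h.mono_set ?_
  rw [uIcc_of_le zero_le_one]
  exact uIcc_subset_Icc hx hy

lemma integrable_of_memLp {g : ℝ → ℝ} (hg : MemLp g 2 unitMeasure) : Integrable g unitMeasure :=
  hg.integrable (by norm_num)

lemma integrable_mul_continuousOn {g u : ℝ → ℝ} (hg : Integrable g unitMeasure)
    (hu : ContinuousOn u (Icc 0 1)) : Integrable (fun x => g x * u x) unitMeasure := by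
  have h : IntervalIntegrable (fun x => g x * u x) volume 0 1 :=
    (intervalIntegrable_of_integrable hg (by simp) (by simp)).mul_continuousOn
      (by rwa [uIcc_of_le zero_le_one])
  rw [intervalIntegrable_iff_integrableOn_Ioc_of_le zero_le_one,
    integrableOn_Ioc_iff_integrableOn_Ioo] at h
  exact h

lemma integrable_of_continuousOn {u : ℝ → ℝ} (hu : ContinuousOn u (Icc 0 1)) :
    Integrable u unitMeasure :=
  (hu.integrableOn_Icc (μ := volume)).mono_set Ioo_subset_Icc_self

lemma memLp_of_continuousOn {u : ℝ → ℝ} (hu : ContinuousOn u (Icc 0 1)) :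
    MemLp u 2 unitMeasure := by
  obtain ⟨C, hC⟩ := isCompact_Icc.exists_bound_of_continuousOn hu
  refine MemLp.of_bound (integrable_of_continuousOn hu).aestronglyMeasurable C ?_
  filter_upwards [ae_restrict_mem measurableSet_Ioo] with x hx
  exact hC x (Ioo_subset_Icc_self hx)

namespace IsPrim

variable {u g w h : ℝ → ℝ}

lemma absolutelyContinuousOnInterval_add_integral (hg : Integrable g unitMeasure) (c : ℝ) :
    AbsolutelyContinuousOnInterval (fun x => c + ∫ t in (0 : ℝ)..x, g t) 0 1 := by
  refine AbsolutelyContinuousOnInterval.add (f := fun _ => c) ?_ ?_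
  · exact (LipschitzWith.const c).lipschitzOnWith.absolutelyContinuousOnInterval
  · exact (intervalIntegrable_of_integrable hg (by simp)
      (by simp)).absolutelyContinuousOnInterval_intervalIntegral (by simp)

lemma continuousOn (hu : IsPrim u g) : ContinuousOn u (Icc 0 1) := by
  have := (absolutelyContinuousOnInterval_add_integral hu.integrable (u 0)).continuousOn
  rw [uIcc_of_le zero_le_one] at this
  exact this.congr hu.eq_add_integral

lemma ae_deriv (hg : Integrable g unitMeasure) (c : ℝ) :
    ∀ᵐ x, x ∈ Icc (0 : ℝ) 1 → deriv (fun x => c + ∫ t in (0 : ℝ)..x, g t) x = g x := by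
  filter_upwards [(intervalIntegrable_of_integrable hg (x := 0) (y := 1) (by simp)
    (by simp)).ae_hasDerivAt_integral] with x hx hx1
  rw [uIcc_of_le zero_le_one] at hx
  exact ((hx hx1 0 (by simp)).const_add c).deriv

/-- The product rule for absolutely continuous functions. -/
lemma mul (hu : IsPrim u g) (hw : IsPrim w h) :
    IsPrim (fun x => u x * w x) (fun x => g x * w x + u x * h x) where
  integrable := by
    refine (integrable_mul_continuousOn hu.integrable hw.continuousOn).add ?_
    simpa only [mul_comm] using integrable_mul_continuousOn hw.integrable hu.continuousOn
  eq_add_integral := by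
    intro x hx
    have hsub : uIcc 0 x ⊆ uIcc (0 : ℝ) 1 := by
      rw [uIcc_of_le hx.1, uIcc_of_le zero_le_one]; exact Icc_subset_Icc_right hx.2
    have key := ((absolutelyContinuousOnInterval_add_integral hu.integrable (u 0)).mono
      hsub).integral_deriv_mul_eq_sub
      ((absolutelyContinuousOnInterval_add_integral hw.integrable (w 0)).mono hsub)
    rw [← hu.eq_add_integral x hx, ← hw.eq_add_integral x hx] at key
    simp only [intervalIntegral.integral_same, add_zero] at key
    rw [← sub_eq_iff_eq_add', ← key]
    apply intervalIntegral.integral_congr_ae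
    filter_upwards [ae_deriv hu.integrable (u 0), ae_deriv hw.integrable (w 0)] with y h1 h2 hy
    have hy1 : y ∈ Icc (0 : ℝ) 1 := by
      rw [uIoc_of_le hx.1] at hy
      exact ⟨hy.1.le, hy.2.trans hx.2⟩
    rw [h1 hy1, h2 hy1, ← hu.eq_add_integral y hy1, ← hw.eq_add_integral y hy1]

lemma integral_eq (hu : IsPrim u g) : ∫ x in Ioo (0 : ℝ) 1, g x = u 1 - u 0 := by
  rw [integral_Ioo_eq_intervalIntegral, hu.eq_add_integral 1 (by simp), add_sub_cancel_left]

/-- Integration by parts, for a product vanishing at both ends. -/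
lemma integral_mul_eq_neg (hu : IsPrim u g) (hw : IsPrim w h) (h0 : u 0 * w 0 = 0)
    (h1 : u 1 * w 1 = 0) :
    ∫ x in Ioo (0 : ℝ) 1, u x * h x = -∫ x in Ioo (0 : ℝ) 1, g x * w x := by
  have key := (hu.mul hw).integral_eq
  rw [integral_add (integrable_mul_continuousOn hu.integrable hw.continuousOn)
    (by simpa only [mul_comm] using integrable_mul_continuousOn hw.integrable hu.continuousOn),
    h0, h1] at key
  linarith

lemma of_integral (hg : Integrable g unitMeasure) (c : ℝ) :
    IsPrim (fun x => c + ∫ t in (0 : ℝ)..x, g t) g :=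
  ⟨hg, fun x _ => by simp⟩

lemma congr (hu : IsPrim u g) (h1 : EqOn w u (Icc 0 1)) (h2 : h =ᵐ[unitMeasure] g) :
    IsPrim w h where
  integrable := hu.integrable.congr h2.symm
  eq_add_integral := by
    intro x hx
    rw [h1 hx, h1 (by simp), hu.eq_add_integral x hx]
    congr 1
    apply intervalIntegral.integral_congr_ae
    have h3 : ∀ᵐ y, y ∈ Ioo (0 : ℝ) 1 → h y = g y := (ae_restrict_iff' measurableSet_Ioo).1 h2
    have h4 : ∀ᵐ y : ℝ, y ≠ 1 := by simp [ae_iff, measure_singleton]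
    filter_upwards [h3, h4] with y hy hy1 hyx
    rw [uIoc_of_le hx.1] at hyx
    exact (hy ⟨hyx.1, lt_of_le_of_ne (hyx.2.trans hx.2) hy1⟩).symm

/-- A function that is continuous on `[0,1]`, with a derivative in the open interval that extends
continuously, is a primitive of this derivative. -/
lemma of_hasDerivAt (hu : ContinuousOn u (Icc 0 1))
    (hd : ∀ x ∈ Ioo (0 : ℝ) 1, HasDerivAt u (g x) x) (hg : ContinuousOn g (Icc 0 1)) :
    IsPrim u g where
  integrable := integrable_of_continuousOn hg
  eq_add_integral := by
    intro x hx
    rw [intervalIntegral.integral_eq_sub_of_hasDerivAt_of_le hx.1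
      (hu.mono (Icc_subset_Icc_right hx.2)) (fun y hy => hd y ⟨hy.1, hy.2.trans_le hx.2⟩)
      (intervalIntegrable_of_integrable (integrable_of_continuousOn hg) (by simp) hx)]
    ring

lemma hasDerivAt (hu : IsPrim u g) (hg : ContinuousOn g (Icc 0 1)) {x : ℝ}
    (hx : x ∈ Ioo (0 : ℝ) 1) : HasDerivAt u (g x) x := by
  have hx' := Ioo_subset_Icc_self hx
  have hnhds : Icc (0 : ℝ) 1 ∈ nhds x := Icc_mem_nhds hx.1 hx.2
  have h1 : HasDerivAt (fun y => ∫ t in (0 : ℝ)..y, g t) (g x) x :=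
    intervalIntegral.integral_hasDerivAt_right
      (intervalIntegrable_of_integrable hu.integrable (by simp) hx')
      ⟨Icc 0 1, hnhds, hg.aestronglyMeasurable measurableSet_Icc⟩ (hg.continuousAt hnhds)
  refine (h1.const_add (u 0)).congr_of_eventuallyEq ?_
  filter_upwards [hnhds] with y hy using hu.eq_add_integral y hy

lemma hasWeakDeriv (hu : IsPrim u g) : HasWeakDeriv u g := by
  intro φ hφ _ hs
  have hφ' : IsPrim φ (deriv φ) := of_hasDerivAt hφ.continuous.continuousOn
    (fun x _ => (hφ.differentiable (by simp) x).hasDerivAt)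
    (hφ.continuous_deriv (by simp)).continuousOn
  have h0 : φ 0 = 0 := image_eq_zero_of_notMem_tsupport fun h => by simpa using hs h
  have h1 : φ 1 = 0 := image_eq_zero_of_notMem_tsupport fun h => by simpa using hs h
  exact hu.integral_mul_eq_neg hφ' (by simp [h0]) (by simp [h1])

end IsPrim

lemma HasWeakDeriv.congr {u g w h : ℝ → ℝ} (hu : HasWeakDeriv u g) (h1 : w =ᵐ[unitMeasure] u)
    (h2 : h =ᵐ[unitMeasure] g) : HasWeakDeriv w h := by
  intro φ hφ hc hs
  have e1 : ∫ x in Ioo (0 : ℝ) 1, w x * deriv φ x = ∫ x in Ioo (0 : ℝ) 1, u x * deriv φ x := by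
    apply integral_congr_ae
    filter_upwards [h1] with x hx
    rw [hx]
  have e2 : ∫ x in Ioo (0 : ℝ) 1, h x * φ x = ∫ x in Ioo (0 : ℝ) 1, g x * φ x := by
    apply integral_congr_ae
    filter_upwards [h2] with x hx
    rw [hx]
  rw [e1, e2, hu φ hφ hc hs]

/-- A test function with vanishing integral is the derivative of a test function. -/
lemma exists_primitive_testFunction {η : ℝ → ℝ} (hη : ContDiff ℝ ∞ η) (hc : HasCompactSupport η)
    (hs : tsupport η ⊆ Ioo (0 : ℝ) 1) (h0 : ∫ x in (0 : ℝ)..1, η x = 0) :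
    ∃ φ : ℝ → ℝ, ContDiff ℝ ∞ φ ∧ HasCompactSupport φ ∧ tsupport φ ⊆ Ioo (0 : ℝ) 1 ∧
      deriv φ = η := by
  obtain ⟨a, b, ha, hb, hab⟩ : ∃ a b : ℝ, 0 < a ∧ b < 1 ∧ tsupport η ⊆ Icc a b := by
    have hK : IsCompact (insert (1 / 2 : ℝ) (tsupport η)) := hc.isCompact.insert _
    have hKs : insert (1 / 2 : ℝ) (tsupport η) ⊆ Ioo 0 1 :=
      insert_subset (by norm_num) hs
    obtain ⟨a, ha⟩ := hK.exists_isLeast (insert_nonempty _ _)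
    obtain ⟨b, hb⟩ := hK.exists_isGreatest (insert_nonempty _ _)
    exact ⟨a, b, (hKs ha.1).1, (hKs hb.1).2, fun x hx =>
      ⟨ha.2 (mem_insert_of_mem _ hx), hb.2 (mem_insert_of_mem _ hx)⟩⟩
  have hz : ∀ x, x ∉ Icc a b → η x = 0 := fun x hx =>
    image_eq_zero_of_notMem_tsupport fun h => hx (hab h)
  have hint : ∀ x y, IntervalIntegrable η volume x y := fun x y =>
    hη.continuous.intervalIntegrable _ _
  have hd : ∀ x, HasDerivAt (fun y => ∫ t in (0 : ℝ)..y, η t) (η x) x := fun x =>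
    intervalIntegral.integral_hasDerivAt_right (hint _ _)
      (hη.continuous.stronglyMeasurableAtFilter _ _) hη.continuous.continuousAt
  have hderiv : deriv (fun y => ∫ t in (0 : ℝ)..y, η t) = η := funext fun x => (hd x).deriv
  have hvanish : ∀ x, x ∉ Icc a b → ∫ t in (0 : ℝ)..x, η t = 0 := by
    intro x hx
    rw [mem_Icc, not_and_or, not_le, not_le] at hx
    rcases hx with hx | hx
    · rw [intervalIntegral.integral_congr (g := fun _ => 0), intervalIntegral.integral_zero]
      intro y hy
      refine hz y fun h => ?_
      have := hy.2
      exact absurd (h.1.trans this) (not_le.2 (max_lt ha hx))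
    · rw [← intervalIntegral.integral_add_adjacent_intervals (hint 0 1) (hint 1 x), h0, zero_add,
        intervalIntegral.integral_congr (g := fun _ => 0), intervalIntegral.integral_zero]
      intro y hy
      refine hz y fun h => ?_
      have := hy.1
      exact absurd (this.trans h.2) (not_le.2 (lt_min hb hx))
  refine ⟨fun x => ∫ t in (0 : ℝ)..x, η t, ?_, HasCompactSupport.intro isCompact_Icc hvanish,
    ?_, hderiv⟩
  · rw [contDiff_infty_iff_deriv, hderiv]
    exact ⟨fun x => (hd x).differentiableAt, hη⟩
  · have : tsupport (fun x => ∫ t in (0 : ℝ)..x, η t) ⊆ Icc a b := by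
      refine closure_minimal (fun x hx => ?_) isClosed_Icc
      by_contra h
      exact hx (hvanish x h)
    exact this.trans fun x hx => ⟨ha.trans_le hx.1, hx.2.trans_lt hb⟩

/-- The lemma of du Bois-Reymond: a function with vanishing weak derivative is constant. -/
lemma HasWeakDeriv.ae_eq_const {w : ℝ → ℝ} (hw : Integrable w unitMeasure)
    (h : HasWeakDeriv w 0) : ∃ c : ℝ, w =ᵐ[unitMeasure] fun _ => c := by
  -- a fixed test function of integral one
  let β : ContDiffBump (1 / 2 : ℝ) := ⟨1 / 8, 1 / 4, by norm_num, by norm_num⟩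
  set χ : ℝ → ℝ := β.normed volume with hχ
  have χs : tsupport χ ⊆ Ioo (0 : ℝ) 1 := by
    rw [hχ, β.tsupport_normed_eq, Real.closedBall_eq_Icc]
    intro x hx
    have h1 := hx.1
    have h2 := hx.2
    simp only [β] at h1 h2
    constructor <;> linarith
  have χc : ContDiff ℝ ∞ χ := β.contDiff_normed
  have toInt : ∀ η : ℝ → ℝ, tsupport η ⊆ Ioo (0 : ℝ) 1 →
      ∫ x in (0 : ℝ)..1, η x = ∫ x, η x := by
    intro η hη
    rw [← integral_Ioo_eq_intervalIntegral]
    exact setIntegral_eq_integral_of_forall_compl_eq_zero fun x hx =>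
      image_eq_zero_of_notMem_tsupport fun h => hx (hη h)
  have χi : ∫ x in (0 : ℝ)..1, χ x = 1 := by
    rw [toInt χ χs, hχ, β.integral_normed]
  refine ⟨∫ x in Ioo (0 : ℝ) 1, w x * χ x, ?_⟩
  set c := ∫ x in Ioo (0 : ℝ) 1, w x * χ x with hc
  have key : ∀ᵐ x : ℝ, x ∈ Ioo (0 : ℝ) 1 → w x - c = 0 := by
    refine isOpen_Ioo.ae_eq_zero_of_integral_contDiff_smul_eq_zero ?_ ?_
    · exact IntegrableOn.locallyIntegrableOn (hw.sub (integrable_const c))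
    · intro ψ hψ ψc ψs
      set a := ∫ x, ψ x with ha
      obtain ⟨φ, hφ, φc, φs, hφd⟩ := exists_primitive_testFunction
        (η := fun x => ψ x - a * χ x) (hψ.sub (contDiff_const.mul χc))
        (ψc.sub (β.hasCompactSupport_normed.mul_left))
        ((tsupport_sub _ _).trans (union_subset ψs
          ((closure_mono (Function.support_mul_subset_right _ _)).trans χs)))
        (by
          rw [intervalIntegral.integral_sub (hψ.continuous.intervalIntegrable _ _)
            ((χc.continuous.intervalIntegrable _ _).const_mul a),
            intervalIntegral.integral_const_mul, χi, toInt ψ ψs, mul_one, sub_self])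
      have h1 := h φ hφ φc φs
      rw [hφd] at h1
      simp only [Pi.zero_apply, zero_mul, integral_zero, neg_zero] at h1
      have i1 : Integrable (fun x => w x * ψ x) unitMeasure :=
        integrable_mul_continuousOn hw hψ.continuous.continuousOn
      have i2 : Integrable (fun x => w x * χ x) unitMeasure :=
        integrable_mul_continuousOn hw χc.continuous.continuousOn
      have i3 : Integrable ψ unitMeasure := integrable_of_continuousOn hψ.continuous.continuousOn
      have e1 : ∀ x, w x * (ψ x - a * χ x) = w x * ψ x - a * (w x * χ x) := fun x => by ring
      simp only [e1] at h1
      rw [integral_sub i1 (i2.const_mul a), integral_const_mul, ← hc] at h1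
      have e2 : ∫ x, ψ x • (w x - c) = ∫ x in Ioo (0 : ℝ) 1, (w x * ψ x - c * ψ x) := by
        rw [← setIntegral_eq_integral_of_forall_compl_eq_zero (s := Ioo (0 : ℝ) 1)]
        · congr 1
          funext x
          rw [smul_eq_mul]; ring
        · intro x hx
          rw [image_eq_zero_of_notMem_tsupport fun h => hx (ψs h), zero_smul]
      rw [e2, integral_sub i1 (i3.const_mul c), integral_const_mul,
        integral_Ioo_eq_intervalIntegral ψ, toInt ψ ψs, ← ha]
      linarith
  exact (ae_restrict_iff' measurableSet_Ioo).2 (key.mono fun x hx h => sub_eq_zero.1 (hx h))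

/-- A function with a weak derivative has an absolutely continuous representative. -/
lemma HasWeakDeriv.exists_isPrim {u g : ℝ → ℝ} (h : HasWeakDeriv u g)
    (hu : Integrable u unitMeasure) (hg : Integrable g unitMeasure) :
    ∃ w, IsPrim w g ∧ u =ᵐ[unitMeasure] w := by
  have hP := IsPrim.of_integral hg 0
  set P : ℝ → ℝ := fun x => 0 + ∫ t in (0 : ℝ)..x, g t
  have hPi : Integrable P unitMeasure := integrable_of_continuousOn hP.continuousOn
  have hd : HasWeakDeriv (fun x => u x - P x) 0 := by
    intro φ hφ hc hs
    have hφ' := (hφ.continuous_deriv (by simp)).continuousOn (s := Icc (0 : ℝ) 1)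
    simp only [sub_mul]
    rw [integral_sub (integrable_mul_continuousOn hu hφ')
      (integrable_mul_continuousOn hPi hφ'), h φ hφ hc hs, hP.hasWeakDeriv φ hφ hc hs]
    simp
  obtain ⟨c, hc⟩ := hd.ae_eq_const (hu.sub hPi)
  refine ⟨_, IsPrim.of_integral hg c, ?_⟩
  filter_upwards [hc] with x hx
  simp only [Pi.sub_apply, P] at hx
  linarith

/-! ### The Dirichlet problem `v'' = g` -/

lemma abs_integral_le_norm (g : L2) {x : ℝ} (hx : x ∈ Icc (0 : ℝ) 1) :
    |∫ t in (0 : ℝ)..x, g t| ≤ ‖g‖ := by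
  have hg : Integrable g unitMeasure := integrable_of_memLp (Lp.memLp g)
  calc |∫ t in (0 : ℝ)..x, g t| ≤ ∫ t in (0 : ℝ)..x, ‖g t‖ :=
        intervalIntegral.abs_integral_le_integral_abs hx.1
    _ ≤ ∫ t in (0 : ℝ)..1, ‖g t‖ :=
        intervalIntegral.integral_mono_interval le_rfl hx.1 hx.2
          (Filter.Eventually.of_forall fun _ => norm_nonneg _)
          (intervalIntegrable_of_integrable hg.norm (by simp) (by simp))
    _ = ∫ t, ‖g t‖ ∂unitMeasure := (integral_Ioo_eq_intervalIntegral _).symm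
    _ ≤ ‖g‖ := by
        rw [integral_norm_eq_lintegral_enorm hg.aestronglyMeasurable,
          ← eLpNorm_one_eq_lintegral_enorm, Lp.norm_def]
        exact ENNReal.toReal_mono (Lp.eLpNorm_ne_top g)
          (eLpNorm_le_eLpNorm_of_exponent_le (by norm_num) hg.aestronglyMeasurable)

lemma norm_le_of_ae_abs_le {f : L2} {C : ℝ} (hC : 0 ≤ C) (h : ∀ᵐ x ∂unitMeasure, |f x| ≤ C) :
    ‖f‖ ≤ C := by
  simpa [measureUnivNNReal] using Lp.norm_le_of_ae_bound (f := f) hC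
    (by simpa only [Real.norm_eq_abs] using h)

lemma integral_congr_of_ae {f g : ℝ → ℝ} (h : f =ᵐ[unitMeasure] g) {x : ℝ}
    (hx : x ∈ Icc (0 : ℝ) 1) : ∫ t in (0 : ℝ)..x, f t = ∫ t in (0 : ℝ)..x, g t := by
  rw [intervalIntegral.integral_of_le hx.1, intervalIntegral.integral_of_le hx.1,
    integral_Ioc_eq_integral_Ioo, integral_Ioc_eq_integral_Ioo]
  exact integral_congr_ae (ae_mono (Measure.restrict_mono (Ioo_subset_Ioo_right hx.2) le_rfl) h)

lemma memLp_integral (g : L2) : MemLp (fun x => ∫ t in (0 : ℝ)..x, g t) 2 unitMeasure := by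
  have h := (IsPrim.of_integral (integrable_of_memLp (Lp.memLp g)) 0).continuousOn
  simp only [zero_add] at h
  exact memLp_of_continuousOn h

/-- The Volterra operator `g ↦ ∫₀ˣ g` on `L²(0,1)`. -/
def volterra : L2 →L[ℝ] L2 :=
  LinearMap.mkContinuous
    { toFun := fun g => (memLp_integral g).toLp _
      map_add' := fun f g => by
        rw [← MemLp.toLp_add]
        apply MemLp.toLp_congr
        filter_upwards [ae_restrict_mem measurableSet_Ioo] with x hx
        have hx' := Ioo_subset_Icc_self hx
        rw [integral_congr_of_ae (Lp.coeFn_add f g) hx']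
        exact intervalIntegral.integral_add
          (intervalIntegrable_of_integrable (integrable_of_memLp (Lp.memLp f)) (by simp) hx')
          (intervalIntegrable_of_integrable (integrable_of_memLp (Lp.memLp g)) (by simp) hx')
      map_smul' := fun c g => by
        rw [RingHom.id_apply, ← MemLp.toLp_const_smul]
        apply MemLp.toLp_congr
        filter_upwards [ae_restrict_mem measurableSet_Ioo] with x hx
        rw [integral_congr_of_ae (Lp.coeFn_smul c g) (Ioo_subset_Icc_self hx)]
        exact intervalIntegral.integral_smul c _ } 1 fun g => by
    rw [one_mul]
    refine norm_le_of_ae_abs_le (norm_nonneg _) ?_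
    filter_upwards [(memLp_integral g).coeFn_toLp, ae_restrict_mem measurableSet_Ioo] with x hx hx1
    exact hx ▸ abs_integral_le_norm g (Ioo_subset_Icc_self hx1)

lemma volterra_ae (g : L2) : volterra g =ᵐ[unitMeasure] fun x => ∫ t in (0 : ℝ)..x, g t :=
  (memLp_integral g).coeFn_toLp

/-- The constant function `1` in `L²(0,1)`. -/
def oneL2 : L2 := (memLp_const (1 : ℝ)).toLp _

lemma inner_oneL2 (g : L2) : inner ℝ oneL2 g = ∫ x in Ioo (0 : ℝ) 1, g x := by
  rw [inner_eq_integral]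
  apply integral_congr_ae
  filter_upwards [(memLp_const (1 : ℝ)).coeFn_toLp (p := 2) (μ := unitMeasure)] with x hx
  rw [oneL2, hx, one_mul]

/-- The derivative `v'` of the solution of `v'' = g`, `v 0 = v 1 = 0`, as a function of `g`. -/
def dirichletDeriv : L2 →L[ℝ] L2 :=
  volterra - ((innerSL ℝ oneL2).comp volterra).smulRight oneL2

/-- The solution operator `g ↦ v` of the problem `v'' = g`, `v 0 = v 1 = 0`. -/
def dirichletSol : L2 →L[ℝ] L2 := volterra.comp dirichletDeriv

/-- The continuous representative of `dirichletDeriv g`. -/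
def dirichletDerivFun (g : L2) (x : ℝ) : ℝ :=
  -(∫ t in Ioo (0 : ℝ) 1, volterra g t) + ∫ t in (0 : ℝ)..x, g t

/-- The continuous representative of `dirichletSol g`. -/
def dirichletSolFun (g : L2) (x : ℝ) : ℝ := ∫ t in (0 : ℝ)..x, dirichletDeriv g t

lemma dirichletDeriv_ae (g : L2) : dirichletDeriv g =ᵐ[unitMeasure] dirichletDerivFun g := by
  have h : dirichletDeriv g = volterra g - (inner ℝ oneL2 (volterra g)) • oneL2 := rfl
  rw [h, inner_oneL2]
  filter_upwards [Lp.coeFn_sub (volterra g) ((∫ t in Ioo (0 : ℝ) 1, volterra g t) • oneL2),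
    Lp.coeFn_smul (∫ t in Ioo (0 : ℝ) 1, volterra g t) oneL2, volterra_ae g,
    (memLp_const (1 : ℝ)).coeFn_toLp (p := 2) (μ := unitMeasure)] with x h1 h2 h3 h4
  rw [h1, Pi.sub_apply, h2, Pi.smul_apply, h3, oneL2, h4, dirichletDerivFun, smul_eq_mul]
  ring

lemma dirichletSol_ae (g : L2) : dirichletSol g =ᵐ[unitMeasure] dirichletSolFun g :=
  volterra_ae (dirichletDeriv g)

lemma isPrim_dirichletDerivFun (g : L2) : IsPrim (dirichletDerivFun g) g :=
  IsPrim.of_integral (integrable_of_memLp (Lp.memLp g)) _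

lemma isPrim_dirichletSolFun (g : L2) : IsPrim (dirichletSolFun g) (dirichletDerivFun g) := by
  have h := IsPrim.of_integral (integrable_of_memLp (Lp.memLp (dirichletDeriv g))) 0
  simp only [zero_add] at h
  exact h.congr (fun _ _ => rfl) (dirichletDeriv_ae g).symm

lemma dirichletSolFun_zero (g : L2) : dirichletSolFun g 0 = 0 := by simp [dirichletSolFun]

lemma dirichletSolFun_one (g : L2) : dirichletSolFun g 1 = 0 := by
  have h : dirichletDeriv g = volterra g - (inner ℝ oneL2 (volterra g)) • oneL2 := rfl
  have h1 : inner ℝ oneL2 oneL2 = (1 : ℝ) := by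
    rw [inner_oneL2, oneL2, integral_congr_ae ((memLp_const (1 : ℝ)).coeFn_toLp (p := 2))]
    simp
  rw [dirichletSolFun, ← integral_Ioo_eq_intervalIntegral, ← inner_oneL2, h, inner_sub_right,
    inner_smul_right, h1, mul_one, sub_self]

lemma abs_dirichletSolFun_le (g : L2) {x : ℝ} (hx : x ∈ Icc (0 : ℝ) 1) :
    |dirichletSolFun g x| ≤ ‖dirichletDeriv g‖ :=
  abs_integral_le_norm _ hx

lemma abs_dirichletDerivFun_le (g : L2) {x : ℝ} (hx : x ∈ Icc (0 : ℝ) 1) :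
    |dirichletDerivFun g x| ≤ 2 * ‖g‖ := by
  have h1 : |∫ t in Ioo (0 : ℝ) 1, volterra g t| ≤ ‖g‖ := by
    rw [integral_Ioo_eq_intervalIntegral]
    refine (abs_integral_le_norm _ (by simp)).trans ?_
    have := volterra.le_of_opNorm_le (LinearMap.mkContinuous_norm_le _ zero_le_one _) g
    rwa [one_mul] at this
  have h2 := abs_integral_le_norm g hx
  calc |dirichletDerivFun g x| ≤ _ := abs_add_le _ _
    _ ≤ 2 * ‖g‖ := by rw [abs_neg]; linarith

lemma memH2H10_dirichletSolFun (g : L2) :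
    MemH2H10 (dirichletSolFun g) (dirichletDeriv g) g where
  continuousOn := (isPrim_dirichletSolFun g).continuousOn
  left := dirichletSolFun_zero g
  right := dirichletSolFun_one g
  memLp₁ := Lp.memLp _
  memLp₂ := Lp.memLp _
  weakDeriv₁ := (isPrim_dirichletSolFun g).hasWeakDeriv.congr (ae_eq_refl _) (dirichletDeriv_ae g)
  weakDeriv₂ := (isPrim_dirichletDerivFun g).hasWeakDeriv.congr (dirichletDeriv_ae g)
    (ae_eq_refl _)

/-- Every element of `H² ∩ H¹₀` solves the Dirichlet problem for its second derivative. -/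
lemma MemH2H10.eq_dirichlet {v v₁ v₂ : ℝ → ℝ} (h : MemH2H10 v v₁ v₂) {g : L2}
    (hg : g =ᵐ[unitMeasure] v₂) :
    EqOn v (dirichletSolFun g) (Icc 0 1) ∧ v₁ =ᵐ[unitMeasure] dirichletDeriv g := by
  obtain ⟨w₁, hw₁, hvw₁⟩ := h.weakDeriv₂.exists_isPrim (integrable_of_memLp h.memLp₁)
    (integrable_of_memLp h.memLp₂)
  obtain ⟨w, hw, hvw⟩ := h.weakDeriv₁.exists_isPrim (integrable_of_continuousOn h.continuousOn)
    (integrable_of_memLp h.memLp₁)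
  have hvw' : EqOn v w (Icc 0 1) := by
    refine Measure.eqOn_of_ae_eq (μ := volume) (s := Icc (0 : ℝ) 1) ?_ h.continuousOn
      hw.continuousOn (closure_interior_Icc zero_ne_one).symm.subset
    rwa [Filter.EventuallyEq, ← restrict_Ioo_eq_restrict_Icc]
  have hv := hw.congr hvw' hvw₁.symm
  set d := w₁ 0 - dirichletDerivFun g 0 with hd
  have hw₁d : ∀ x ∈ Icc (0 : ℝ) 1, w₁ x = dirichletDerivFun g x + d := by
    intro x hx
    rw [hw₁.eq_add_integral x hx, (isPrim_dirichletDerivFun g).eq_add_integral x hx,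
      integral_congr_of_ae hg hx, hd]
    ring
  have hv1 : ∀ x ∈ Icc (0 : ℝ) 1, v x = dirichletSolFun g x + x * d := by
    intro x hx
    rw [hv.eq_add_integral x hx, h.left, zero_add,
      (isPrim_dirichletSolFun g).eq_add_integral x hx, dirichletSolFun_zero, zero_add]
    rw [intervalIntegral.integral_congr (g := fun t => dirichletDerivFun g t + d)]
    · rw [intervalIntegral.integral_add (intervalIntegrable_of_integrable
        (isPrim_dirichletSolFun g).integrable (by simp) hx) (by simp)]
      simp
    · intro y hy
      rw [uIcc_of_le hx.1] at hy
      exact hw₁d y ⟨hy.1, hy.2.trans hx.2⟩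
  have hd0 : d = 0 := by
    have := hv1 1 (by simp)
    rw [h.right, dirichletSolFun_one] at this
    linarith
  rw [hd0] at hw₁d hv1
  refine ⟨fun x hx => by simpa using hv1 x hx, ?_⟩
  filter_upwards [hvw₁, dirichletDeriv_ae g, ae_restrict_mem measurableSet_Ioo] with x h1 h2 h3
  rw [h1, h2, hw₁d x (Ioo_subset_Icc_self h3), add_zero]

lemma inner_dirichletDeriv (g h : L2) :
    inner ℝ (dirichletDeriv g) (dirichletDeriv h) = -inner ℝ (dirichletSol g) h := by
  have key := (isPrim_dirichletSolFun g).integral_mul_eq_neg (isPrim_dirichletDerivFun h)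
    (by simp [dirichletSolFun_zero]) (by simp [dirichletSolFun_one])
  have e1 : inner ℝ (dirichletSol g) h = ∫ x in Ioo (0 : ℝ) 1, dirichletSolFun g x * h x := by
    rw [inner_eq_integral]
    apply integral_congr_ae
    filter_upwards [dirichletSol_ae g] with x hx
    rw [hx]
  have e2 : inner ℝ (dirichletDeriv g) (dirichletDeriv h)
      = ∫ x in Ioo (0 : ℝ) 1, dirichletDerivFun g x * dirichletDerivFun h x := by
    rw [inner_eq_integral]
    apply integral_congr_ae
    filter_upwards [dirichletDeriv_ae g, dirichletDeriv_ae h] with x h1 h2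
    rw [h1, h2]
  rw [e1, e2, key, neg_neg]

lemma inner_dirichletSol_comm (g h : L2) :
    inner ℝ (dirichletSol g) h = inner ℝ g (dirichletSol h) := by
  have h1 := inner_dirichletDeriv g h
  have h2 := inner_dirichletDeriv h g
  rw [real_inner_comm] at h2
  rw [real_inner_comm (dirichletSol h) g]
  linarith

lemma freq_pos (k : ℕ) : 0 < freq k := mul_pos (by positivity) Real.pi_pos

lemma one_le_freq (k : ℕ) : 1 ≤ freq k := by
  have h1 : (1 : ℝ) ≤ k + 1 := by linarith [k.cast_nonneg (α := ℝ)]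
  have h2 : (1 : ℝ) ≤ Real.pi := by linarith [Real.pi_gt_three]
  exact one_le_mul_of_one_le_of_one_le h1 h2

/-- The sines are eigenfunctions of the Dirichlet problem. -/
lemma dirichletSol_sineMode (k : ℕ) :
    dirichletSol (sineMode k) = -((freq k ^ 2)⁻¹) • sineMode k := by
  have hs : ContDiff ℝ ∞ (sineFun k) := by unfold sineFun; fun_prop
  have hs' : Continuous (deriv (sineFun k)) := hs.continuous_deriv (by simp)
  have hp1 : IsPrim (sineFun k) (deriv (sineFun k)) := IsPrim.of_hasDerivAt
    hs.continuous.continuousOn (fun x _ => (hs.differentiable (by simp) x).hasDerivAt)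
    hs'.continuousOn
  have hp2 : IsPrim (deriv (sineFun k)) (fun x => -(freq k) ^ 2 * sineFun k x) :=
    IsPrim.of_hasDerivAt hs'.continuousOn
      (fun x _ => by
        rw [← congrFun (deriv_deriv_sineFun k) x]
        have : ContDiff ℝ ∞ (deriv (sineFun k)) := (contDiff_infty_iff_deriv.1 hs).2
        exact (this.differentiable (by simp) x).hasDerivAt)
      (continuous_const.mul hs.continuous).continuousOn
  have hm : MemH2H10 (sineFun k) (deriv (sineFun k)) (fun x => -(freq k) ^ 2 * sineFun k x) :=
    { continuousOn := hs.continuous.continuousOn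
      left := sineFun_zero k
      right := sineFun_one k
      memLp₁ := memLp_of_continuousOn hs'.continuousOn
      memLp₂ := (memLp_sineFun k).const_mul _
      weakDeriv₁ := hp1.hasWeakDeriv
      weakDeriv₂ := hp2.hasWeakDeriv }
  have hg : ((-(freq k ^ 2)) • sineMode k : L2) =ᵐ[unitMeasure]
      fun x => -(freq k) ^ 2 * sineFun k x := by
    filter_upwards [Lp.coeFn_smul (-(freq k ^ 2)) (sineMode k), (memLp_sineFun k).coeFn_toLp]
      with x h1 h2
    rw [h1, Pi.smul_apply, sineMode, h2, smul_eq_mul]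
  have h1 := (hm.eq_dirichlet hg).1
  have h2 : dirichletSol ((-(freq k ^ 2)) • sineMode k) = sineMode k := by
    apply Lp.ext
    filter_upwards [dirichletSol_ae ((-(freq k ^ 2)) • sineMode k), (memLp_sineFun k).coeFn_toLp,
      ae_restrict_mem measurableSet_Ioo] with x h3 h4 h5
    rw [h3, sineMode, h4, h1 (Ioo_subset_Icc_self h5), sineMode]
  have h3 : freq k ^ 2 ≠ 0 := pow_ne_zero 2 (freq_pos k).ne'
  rw [map_smul] at h2
  conv_rhs => rw [← h2, smul_smul, neg_mul_neg, inv_mul_cancel₀ h3, one_smul]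

lemma sineCoeff_dirichletSol (g : L2) (k : ℕ) :
    sineCoeff (dirichletSol g) k = -(sineCoeff g k / freq k ^ 2) := by
  rw [← inner_sineMode, ← inner_dirichletSol_comm, dirichletSol_sineMode, real_inner_smul_left,
    inner_sineMode]
  ring

/-- With `v` the solution of `v'' = g`, the energy `‖v'‖²` in terms of the coefficients of `v`. -/
lemma hasSum_norm_dirichletDeriv_sq (g : L2) :
    HasSum (fun k => freq k ^ 2 * sineCoeff (dirichletSol g) k ^ 2) (‖dirichletDeriv g‖ ^ 2) := by
  rw [← real_inner_self_eq_norm_sq, inner_dirichletDeriv]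
  refine (hasSum_sineCoeff_mul _ _).neg.congr_fun fun k => ?_
  have h3 : freq k ≠ 0 := (freq_pos k).ne'
  rw [sineCoeff_dirichletSol]
  field_simp

/-- With `v` the solution of `v'' = g`, the energy `‖v''‖²` in terms of the coefficients of `v`. -/
lemma hasSum_norm_sq_dirichletSol (g : L2) :
    HasSum (fun k => freq k ^ 4 * sineCoeff (dirichletSol g) k ^ 2) (‖g‖ ^ 2) := by
  refine (hasSum_sineCoeff_sq g).congr_fun fun k => ?_
  have h3 : freq k ≠ 0 := (freq_pos k).ne'
  rw [sineCoeff_dirichletSol]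
  field_simp

/-- Prescribing the sine coefficients of an element of `H² ∩ H¹₀`. -/
lemma exists_dirichletSol_sineCoeff_eq (g : L2) {d : ℕ → ℝ} {B : ℝ}
    (hd : ∀ k, |freq k ^ 2 * d k| ≤ B) :
    ∃ f : L2, ∀ k, sineCoeff (dirichletSol f) k = d k * sineCoeff g k := by
  obtain ⟨f, hf, -⟩ := exists_sineCoeff_eq g (d := fun k => -(freq k ^ 2 * d k)) (B := B)
    (fun k => by rw [abs_neg]; exact hd k)
  refine ⟨f, fun k => ?_⟩
  have h3 : freq k ≠ 0 := (freq_pos k).ne'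
  rw [sineCoeff_dirichletSol, hf]
  field_simp

/-! ### The energy form, weak solutions and the variational principle -/

/-- Multiplication by an essentially bounded function, as an operator on `L²(0,1)`. -/
def mulOp {r : ℝ → ℝ} (hr : MemLp r ⊤ unitMeasure) : L2 →L[ℝ] L2 :=
  (ContinuousLinearMap.mul ℝ ℝ).holderL unitMeasure ⊤ 2 2 (hr.toLp r)

lemma mulOp_ae {r : ℝ → ℝ} (hr : MemLp r ⊤ unitMeasure) (g : L2) :
    mulOp hr g =ᵐ[unitMeasure] fun x => r x * g x := by
  filter_upwards [(ContinuousLinearMap.mul ℝ ℝ).coeFn_holder (r := 2) (hr.toLp r) g,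
    hr.coeFn_toLp] with x h1 h2
  rw [← h2]
  exact h1

lemma inner_mulOp_comm {r : ℝ → ℝ} (hr : MemLp r ⊤ unitMeasure) (f g : L2) :
    inner ℝ (mulOp hr f) g = inner ℝ f (mulOp hr g) := by
  rw [inner_eq_integral, inner_eq_integral]
  apply integral_congr_ae
  filter_upwards [mulOp_ae hr f, mulOp_ae hr g] with x h1 h2
  rw [h1, h2]; ring

lemma norm_mulOp_le {r : ℝ → ℝ} (hr : MemLp r ⊤ unitMeasure) {M : ℝ}
    (hM : ∀ᵐ x ∂unitMeasure, |r x| ≤ M) (g : L2) : ‖mulOp hr g‖ ≤ M * ‖g‖ := by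
  refine Lp.norm_le_mul_norm_of_ae_le_mul ?_
  filter_upwards [mulOp_ae hr g, hM] with x h1 h2
  rw [h1, norm_mul]
  exact mul_le_mul_of_nonneg_right h2 (norm_nonneg _)

lemma le_norm_mulOp {r : ℝ → ℝ} (hr : MemLp r ⊤ unitMeasure) {m : ℝ} (hm : 0 ≤ m)
    (h : ∀ᵐ x ∂unitMeasure, m ≤ |r x|) (g : L2) : m * ‖g‖ ≤ ‖mulOp hr g‖ := by
  have h0 : ‖m • g‖ ≤ ‖mulOp hr g‖ := by
    refine Lp.norm_le_norm_of_ae_le ?_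
    filter_upwards [mulOp_ae hr g, h, Lp.coeFn_smul m g] with x h1 h2 h3
    rw [h1, h3, norm_mul, Pi.smul_apply, norm_smul, Real.norm_of_nonneg hm]
    exact mul_le_mul_of_nonneg_right h2 (norm_nonneg _)
  rwa [norm_smul, Real.norm_of_nonneg hm] at h0

/-- The bilinear form of the weak formulation. The elements `v`, `φ` of `H² ∩ H¹₀` are
parametrized by their second derivatives `g`, `h`, which range over all of `L²(0,1)`. -/
def energy (ε lam κ : ℝ) {r : ℝ → ℝ} (hr : MemLp r ⊤ unitMeasure) (g h : L2) : ℝ :=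
  ε * inner ℝ g h + lam * inner ℝ (dirichletDeriv g) (dirichletDeriv h)
    + κ * inner ℝ (dirichletSol g) (dirichletSol h)
    + inner ℝ (mulOp hr (dirichletSol g)) (mulOp hr (dirichletSol h))

section

variable {ε lam κ : ℝ} {r : ℝ → ℝ} (hr : MemLp r ⊤ unitMeasure)

lemma energy_self (g : L2) : energy ε lam κ hr g g = ε * ‖g‖ ^ 2 + lam * ‖dirichletDeriv g‖ ^ 2
    + κ * ‖dirichletSol g‖ ^ 2 + ‖mulOp hr (dirichletSol g)‖ ^ 2 := by
  simp only [energy, real_inner_self_eq_norm_sq]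

lemma le_energy_self (hlam : 0 ≤ lam) (hκ : 0 < κ) (g : L2) :
    ε * ‖g‖ ^ 2 ≤ energy ε lam κ hr g g := by
  rw [energy_self]
  have : 0 ≤ lam * ‖dirichletDeriv g‖ ^ 2 + κ * ‖dirichletSol g‖ ^ 2
    + ‖mulOp hr (dirichletSol g)‖ ^ 2 := by positivity
  linarith

lemma energy_sub_sub (g h : L2) : energy ε lam κ hr (g - h) (g - h)
    = energy ε lam κ hr g g - 2 * energy ε lam κ hr h g + energy ε lam κ hr h h := by
  simp only [energy, map_sub, inner_sub_left, inner_sub_right]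
  rw [real_inner_comm h g, real_inner_comm (dirichletDeriv h) (dirichletDeriv g),
    real_inner_comm (dirichletSol h) (dirichletSol g),
    real_inner_comm (mulOp hr (dirichletSol h)) (mulOp hr (dirichletSol g))]
  ring

/-- Existence in the weak formulation, by the theorem of Lax and Milgram. -/
lemma exists_energy_eq (hε : 0 < ε) (hlam : 0 ≤ lam) (hκ : 0 < κ) (F : L2) :
    ∃ g : L2, ∀ h : L2, energy ε lam κ hr g h = inner ℝ F (dirichletSol h) := by
  let I : L2 →L[ℝ] L2 →L[ℝ] ℝ := isBoundedBilinearMap_inner.toContinuousLinearMap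
  have hI : ∀ g h, I g h = inner ℝ g h := fun g h => rfl
  let B : L2 →L[ℝ] L2 →L[ℝ] ℝ := ε • I + lam • I.bilinearComp dirichletDeriv dirichletDeriv
    + κ • I.bilinearComp dirichletSol dirichletSol
    + I.bilinearComp ((mulOp hr).comp dirichletSol) ((mulOp hr).comp dirichletSol)
  have hB : ∀ g h, B g h = energy ε lam κ hr g h := by
    intro g h
    simp [B, hI, energy]
  have hc : IsCoercive B := by
    refine ⟨ε, hε, fun g => ?_⟩
    rw [hB, mul_assoc, ← sq]
    exact le_energy_self hr hlam hκ g
  refine ⟨hc.continuousLinearEquivOfBilin.symm (ContinuousLinearMap.adjoint dirichletSol F),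
    fun h => ?_⟩
  rw [← hB, ← hc.continuousLinearEquivOfBilin_apply, ContinuousLinearEquiv.apply_symm_apply,
    ContinuousLinearMap.adjoint_inner_left]

lemma weakForm_eq_energy {v v₁ v₂ φ φ₁ φ₂ : ℝ → ℝ} (hv : MemH2H10 v v₁ v₂)
    (hφ : MemH2H10 φ φ₁ φ₂) {g h : L2} (hg : g =ᵐ[unitMeasure] v₂) (hh : h =ᵐ[unitMeasure] φ₂) :
    ε * (∫ x in Ioo (0 : ℝ) 1, v₂ x * φ₂ x) + lam * (∫ x in Ioo (0 : ℝ) 1, v₁ x * φ₁ x)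
        + (∫ x in Ioo (0 : ℝ) 1, (κ + r x ^ 2) * v x * φ x) = energy ε lam κ hr g h := by
  obtain ⟨h1, h2⟩ := hv.eq_dirichlet hg
  obtain ⟨h3, h4⟩ := hφ.eq_dirichlet hh
  have e2 : ∫ x in Ioo (0 : ℝ) 1, v₂ x * φ₂ x = inner ℝ g h := by
    rw [inner_eq_integral]
    apply integral_congr_ae
    filter_upwards [hg, hh] with x h5 h6
    rw [h5, h6]
  have e1 : ∫ x in Ioo (0 : ℝ) 1, v₁ x * φ₁ x
      = inner ℝ (dirichletDeriv g) (dirichletDeriv h) := by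
    rw [inner_eq_integral]
    apply integral_congr_ae
    filter_upwards [h2, h4] with x h5 h6
    rw [h5, h6]
  have e0 : ∫ x in Ioo (0 : ℝ) 1, (κ + r x ^ 2) * v x * φ x
      = κ * inner ℝ (dirichletSol g) (dirichletSol h)
        + inner ℝ (mulOp hr (dirichletSol g)) (mulOp hr (dirichletSol h)) := by
    rw [inner_eq_integral, inner_eq_integral, ← integral_const_mul, ← integral_add]
    · apply integral_congr_ae
      filter_upwards [dirichletSol_ae g, dirichletSol_ae h, mulOp_ae hr (dirichletSol g),
        mulOp_ae hr (dirichletSol h), ae_restrict_mem measurableSet_Ioo] with x h5 h6 h7 h8 h9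
      rw [h7, h8, h5, h6, h1 (Ioo_subset_Icc_self h9), h3 (Ioo_subset_Icc_self h9)]
      ring
    · exact ((Lp.memLp (dirichletSol g)).integrable_mul (Lp.memLp (dirichletSol h))).const_mul κ
    · exact (Lp.memLp _).integrable_mul (Lp.memLp _)
  rw [e0, e1, e2, energy]
  ring

lemma integral_mul_eq_inner {f φ φ₁ φ₂ : ℝ → ℝ} {F h : L2} (hF : F =ᵐ[unitMeasure] f)
    (hφ : MemH2H10 φ φ₁ φ₂) (hh : h =ᵐ[unitMeasure] φ₂) :
    ∫ x in Ioo (0 : ℝ) 1, f x * φ x = inner ℝ F (dirichletSol h) := by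
  rw [inner_eq_integral]
  apply integral_congr_ae
  filter_upwards [hF, dirichletSol_ae h, ae_restrict_mem measurableSet_Ioo] with x h1 h2 h3
  rw [h1, h2, (hφ.eq_dirichlet hh).1 (Ioo_subset_Icc_self h3)]

/-- Weak solutions, in terms of their second derivatives. -/
lemma isWeakSol_iff {f v : ℝ → ℝ} {F : L2} (hF : F =ᵐ[unitMeasure] f) :
    IsWeakSol ε lam κ r f v ↔ ∃ g : L2, EqOn v (dirichletSolFun g) (Icc 0 1) ∧
      ∀ h : L2, energy ε lam κ hr g h = inner ℝ F (dirichletSol h) := by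
  constructor
  · rintro ⟨v₁, v₂, hv, hw⟩
    have hg := hv.memLp₂.coeFn_toLp
    refine ⟨hv.memLp₂.toLp v₂, (hv.eq_dirichlet hg).1, fun h => ?_⟩
    have hφ := memH2H10_dirichletSolFun h
    rw [← weakForm_eq_energy hr hv hφ hg (ae_eq_refl _), hw _ _ _ hφ,
      integral_mul_eq_inner hF hφ (ae_eq_refl _)]
  · rintro ⟨g, hv, hg⟩
    have hm := memH2H10_dirichletSolFun g
    have hv' : MemH2H10 v (dirichletDeriv g) g :=
      { continuousOn := hm.continuousOn.congr hv
        left := by rw [hv (by simp), hm.left]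
        right := by rw [hv (by simp), hm.right]
        memLp₁ := hm.memLp₁
        memLp₂ := hm.memLp₂
        weakDeriv₁ := hm.weakDeriv₁.congr
          (by
            filter_upwards [ae_restrict_mem measurableSet_Ioo] with x hx
            exact hv (Ioo_subset_Icc_self hx)) (ae_eq_refl _)
        weakDeriv₂ := hm.weakDeriv₂ }
    refine ⟨_, _, hv', fun φ φ₁ φ₂ hφ => ?_⟩
    have hh := hφ.memLp₂.coeFn_toLp
    rw [weakForm_eq_energy hr hv' hφ (ae_eq_refl _) hh, hg, integral_mul_eq_inner hF hφ hh]

lemma energy_eq_unique (hε : 0 < ε) (hlam : 0 ≤ lam) (hκ : 0 < κ) {F g g' : L2}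
    (hg : ∀ h : L2, energy ε lam κ hr g h = inner ℝ F (dirichletSol h))
    (hg' : ∀ h : L2, energy ε lam κ hr g' h = inner ℝ F (dirichletSol h)) : g = g' := by
  have h1 := energy_sub_sub (ε := ε) (lam := lam) (κ := κ) hr g g'
  have h2 := le_energy_self (ε := ε) hr hlam hκ (g - g')
  rw [hg g, hg' g, hg' g'] at h1
  have h3 := hg g'
  have h4 := hg' g
  have h5 : energy ε lam κ hr g g' = energy ε lam κ hr g' g := by
    simp only [energy]
    rw [real_inner_comm g g', real_inner_comm (dirichletDeriv g) (dirichletDeriv g'),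
      real_inner_comm (dirichletSol g) (dirichletSol g'),
      real_inner_comm (mulOp hr (dirichletSol g)) (mulOp hr (dirichletSol g'))]
  have h6 : ε * ‖g - g'‖ ^ 2 ≤ 0 := by linarith
  have h7 : ‖g - g'‖ ^ 2 ≤ 0 := by
    by_contra hcon
    exact absurd h6 (not_le.2 (mul_pos hε (not_le.1 hcon)))
  exact sub_eq_zero.1 (norm_eq_zero.1 (pow_eq_zero_iff two_ne_zero |>.1
    (le_antisymm h7 (sq_nonneg _))))

/-- Existence and uniqueness of the weak solution. -/
lemma exists_unique_isWeakSol (hr : MemLp r ⊤ unitMeasure) (hε : 0 < ε) (hlam : 0 ≤ lam)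
    (hκ : 0 < κ) (f : L2) :
    ∃ v : ℝ → ℝ, IsWeakSol ε lam κ r f v ∧
      ∀ w : ℝ → ℝ, IsWeakSol ε lam κ r f w → EqOn w v (Icc 0 1) := by
  obtain ⟨g, hg⟩ := exists_energy_eq hr hε hlam hκ f
  refine ⟨dirichletSolFun g, (isWeakSol_iff hr (ae_eq_refl _)).2 ⟨g, fun _ _ => rfl, hg⟩,
    fun w hw => ?_⟩
  obtain ⟨g', hw', hg'⟩ := (isWeakSol_iff hr (ae_eq_refl _)).1 hw
  rwa [energy_eq_unique hr hε hlam hκ hg' hg] at hw'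

lemma hessianForm_eq (hε : 0 < ε) (hlam : 0 ≤ lam) (hκ : 0 < κ) (θ : L2) :
    ∃ g : L2, (∀ h : L2, energy ε lam κ hr g h = inner ℝ (mulOp hr θ) (dirichletSol h)) ∧
      hessianForm ε lam κ r θ = ‖θ‖ ^ 2 - inner ℝ (mulOp hr θ) (dirichletSol g) := by
  have hF := mulOp_ae hr θ
  have hex : ∃ v, IsWeakSol ε lam κ r (fun y => r y * θ y) v := by
    obtain ⟨g, hg⟩ := exists_energy_eq hr hε hlam hκ (mulOp hr θ)
    exact ⟨_, (isWeakSol_iff hr hF).2 ⟨g, fun _ _ => rfl, hg⟩⟩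
  have hsol : IsWeakSol ε lam κ r (fun y => r y * θ y)
      (Linv ε lam κ r (fun y => r y * θ y)) := by
    rw [Linv, dif_pos hex]
    exact hex.choose_spec
  obtain ⟨g, hv, hg⟩ := (isWeakSol_iff hr hF).1 hsol
  refine ⟨g, hg, ?_⟩
  have i1 : Integrable (fun x => θ x * θ x) unitMeasure :=
    (Lp.memLp θ).integrable_mul (Lp.memLp θ)
  have i2 : Integrable (fun x => mulOp hr θ x * dirichletSol g x) unitMeasure :=
    (Lp.memLp (mulOp hr θ)).integrable_mul (Lp.memLp (dirichletSol g))
  rw [← real_inner_self_eq_norm_sq, inner_eq_integral, inner_eq_integral, hessianForm,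
    ← integral_sub i1 i2]
  apply integral_congr_ae
  filter_upwards [hF, dirichletSol_ae g, ae_restrict_mem measurableSet_Ioo] with x h1 h2 h3
  rw [h1, h2, Binv, hv (Ioo_subset_Icc_self h3)]
  ring

/-- The Hessian form is bounded above by the energy functional of every element of `H² ∩ H¹₀`. -/
lemma hessianForm_le (hε : 0 < ε) (hlam : 0 ≤ lam) (hκ : 0 < κ) (θ g : L2) :
    hessianForm ε lam κ r θ ≤ ‖θ‖ ^ 2 - 2 * inner ℝ (mulOp hr θ) (dirichletSol g)
      + energy ε lam κ hr g g := by
  obtain ⟨g₀, hg₀, h⟩ := hessianForm_eq hr hε hlam hκ θ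
  have h1 := energy_sub_sub (ε := ε) (lam := lam) (κ := κ) hr g g₀
  have h2 := le_energy_self (ε := ε) hr hlam hκ (g - g₀)
  have h3 : 0 ≤ ε * ‖g - g₀‖ ^ 2 := by positivity
  rw [hg₀, hg₀] at h1
  rw [h]
  linarith

/-- The weak solution attains the minimum of the energy functional. -/
lemma exists_hessianForm_eq (hε : 0 < ε) (hlam : 0 ≤ lam) (hκ : 0 < κ) (θ : L2) :
    ∃ g : L2, hessianForm ε lam κ r θ = ‖θ‖ ^ 2 - 2 * inner ℝ (mulOp hr θ) (dirichletSol g)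
      + energy ε lam κ hr g g := by
  obtain ⟨g₀, hg₀, h⟩ := hessianForm_eq hr hε hlam hκ θ
  refine ⟨g₀, ?_⟩
  rw [h, hg₀]
  ring

/-- Completing the square in the energy functional. -/
lemma energyFunctional_eq (θ g : L2) :
    ‖θ‖ ^ 2 - 2 * inner ℝ (mulOp hr θ) (dirichletSol g) + energy ε lam κ hr g g
      = ‖θ - mulOp hr (dirichletSol g)‖ ^ 2 + ε * ‖g‖ ^ 2 + lam * ‖dirichletDeriv g‖ ^ 2
        + κ * ‖dirichletSol g‖ ^ 2 := by
  rw [norm_sub_sq_real, ← inner_mulOp_comm, energy_self]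
  ring

end

/-! ### Multiplication by functions of class `H²` -/

lemma IsPrim.add {u g w h : ℝ → ℝ} (hu : IsPrim u g) (hw : IsPrim w h) :
    IsPrim (fun x => u x + w x) (fun x => g x + h x) where
  integrable := hu.integrable.add hw.integrable
  eq_add_integral := by
    intro x hx
    rw [hu.eq_add_integral x hx, hw.eq_add_integral x hx, intervalIntegral.integral_add
      (intervalIntegrable_of_integrable hu.integrable (by simp) hx)
      (intervalIntegrable_of_integrable hw.integrable (by simp) hx)]
    ring

lemma IsPrim.neg {u g : ℝ → ℝ} (hu : IsPrim u g) : IsPrim (fun x => -u x) (fun x => -g x) where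
  integrable := hu.integrable.neg
  eq_add_integral := by
    intro x hx
    rw [hu.eq_add_integral x hx, intervalIntegral.integral_neg, neg_add]

lemma memLp_top_of_continuousOn {u : ℝ → ℝ} (hu : ContinuousOn u (Icc 0 1)) :
    MemLp u ⊤ unitMeasure := by
  obtain ⟨C, hC⟩ := isCompact_Icc.exists_bound_of_continuousOn hu
  refine memLp_top_of_bound (integrable_of_continuousOn hu).aestronglyMeasurable C ?_
  filter_upwards [ae_restrict_mem measurableSet_Ioo] with x hx
  exact hC x (Ioo_subset_Icc_self hx)

lemma norm_dirichletDeriv_le (g : L2) : ‖dirichletDeriv g‖ ≤ 2 * ‖g‖ := by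
  refine norm_le_of_ae_abs_le (by positivity) ?_
  filter_upwards [dirichletDeriv_ae g, ae_restrict_mem measurableSet_Ioo] with x h1 h2
  rw [h1]
  exact abs_dirichletDerivFun_le g (Ioo_subset_Icc_self h2)

lemma norm_dirichletSol_le (g : L2) : ‖dirichletSol g‖ ≤ ‖dirichletDeriv g‖ := by
  refine norm_le_of_ae_abs_le (norm_nonneg _) ?_
  filter_upwards [dirichletSol_ae g, ae_restrict_mem measurableSet_Ioo] with x h1 h2
  rw [h1]
  exact abs_dirichletSolFun_le g (Ioo_subset_Icc_self h2)

/-- Functions of class `H²` multiply `H² ∩ H¹₀` into itself, boundedly in the norms `‖v''‖` and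
`‖v'‖`. -/
lemma exists_dirichletSolFun_eq_mul {φ φ₁ φ₂ : ℝ → ℝ} (h₁ : IsPrim φ φ₁) (h₂ : IsPrim φ₁ φ₂)
    (hφ₂ : MemLp φ₂ 2 unitMeasure) :
    ∃ K : ℝ, 0 < K ∧ ∀ g : L2, ∃ g' : L2,
      (∀ x ∈ Icc (0 : ℝ) 1, dirichletSolFun g' x = φ x * dirichletSolFun g x) ∧
        ‖g'‖ ≤ K * ‖g‖ ∧ ‖dirichletDeriv g'‖ ≤ K * ‖dirichletDeriv g‖ := by
  have m0 := memLp_top_of_continuousOn h₁.continuousOn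
  have m1 := memLp_top_of_continuousOn h₂.continuousOn
  set A := ‖mulOp m0‖ with hA
  set A₁ := ‖mulOp m1‖ with hA₁
  set N := ‖hφ₂.toLp φ₂‖ with hN
  have a0 : 0 ≤ A := norm_nonneg _
  have a1 : 0 ≤ A₁ := norm_nonneg _
  have n0 : 0 ≤ N := norm_nonneg _
  refine ⟨2 * N + 4 * A₁ + A + 1, by positivity, fun g => ?_⟩
  have p0 := isPrim_dirichletSolFun g
  have p1 := isPrim_dirichletDerivFun g
  have mv := memLp_top_of_continuousOn p0.continuousOn
  let g' : L2 := mulOp mv (hφ₂.toLp φ₂) + (2 : ℝ) • mulOp m1 (dirichletDeriv g) + mulOp m0 g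
  have w0 := h₁.mul p0
  have w1 := (h₂.mul p0).add (h₁.mul p1)
  have hg' : g' =ᵐ[unitMeasure] fun x => φ₂ x * dirichletSolFun g x + φ₁ x * dirichletDerivFun g x
      + (φ₁ x * dirichletDerivFun g x + φ x * g x) := by
    filter_upwards [Lp.coeFn_add (mulOp mv (hφ₂.toLp φ₂) + (2 : ℝ) • mulOp m1 (dirichletDeriv g))
      (mulOp m0 g), Lp.coeFn_add (mulOp mv (hφ₂.toLp φ₂)) ((2 : ℝ) • mulOp m1 (dirichletDeriv g)),
      Lp.coeFn_smul (2 : ℝ) (mulOp m1 (dirichletDeriv g)), mulOp_ae mv (hφ₂.toLp φ₂),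
      mulOp_ae m1 (dirichletDeriv g), mulOp_ae m0 g, hφ₂.coeFn_toLp, dirichletDeriv_ae g]
      with x e1 e2 e3 e4 e5 e6 e7 e8
    rw [e1, Pi.add_apply, e2, Pi.add_apply, e3, Pi.smul_apply, e4, e5, e6, e7, e8, smul_eq_mul]
    ring
  have hm : MemH2H10 (fun x => φ x * dirichletSolFun g x)
      (fun x => φ₁ x * dirichletSolFun g x + φ x * dirichletDerivFun g x)
      (fun x => φ₂ x * dirichletSolFun g x + φ₁ x * dirichletDerivFun g x
        + (φ₁ x * dirichletDerivFun g x + φ x * g x)) :=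
    { continuousOn := w0.continuousOn
      left := by simp [dirichletSolFun_zero]
      right := by simp [dirichletSolFun_one]
      memLp₁ := memLp_of_continuousOn w1.continuousOn
      memLp₂ := (Lp.memLp g').ae_eq hg'
      weakDeriv₁ := w0.hasWeakDeriv
      weakDeriv₂ := w1.hasWeakDeriv }
  obtain ⟨q1, q2⟩ := hm.eq_dirichlet hg'
  have hd : dirichletDeriv g' = mulOp m1 (dirichletSol g) + mulOp m0 (dirichletDeriv g) := by
    apply Lp.ext
    filter_upwards [q2, Lp.coeFn_add (mulOp m1 (dirichletSol g)) (mulOp m0 (dirichletDeriv g)),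
      mulOp_ae m1 (dirichletSol g), mulOp_ae m0 (dirichletDeriv g), dirichletSol_ae g,
      dirichletDeriv_ae g] with x e1 e2 e3 e4 e5 e6
    rw [← e1, e2, Pi.add_apply, e3, e4, e5, e6]
  have b1 : ‖mulOp mv (hφ₂.toLp φ₂)‖ ≤ ‖dirichletDeriv g‖ * N := by
    refine norm_mulOp_le mv ?_ _
    filter_upwards [ae_restrict_mem measurableSet_Ioo] with x hx
    exact abs_dirichletSolFun_le g (Ioo_subset_Icc_self hx)
  have b2 : ‖mulOp m1 (dirichletDeriv g)‖ ≤ A₁ * ‖dirichletDeriv g‖ :=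
    (mulOp m1).le_opNorm _
  have b3 : ‖mulOp m0 g‖ ≤ A * ‖g‖ := (mulOp m0).le_opNorm _
  have b4 : ‖mulOp m1 (dirichletSol g)‖ ≤ A₁ * ‖dirichletDeriv g‖ :=
    ((mulOp m1).le_opNorm _).trans (mul_le_mul_of_nonneg_left (norm_dirichletSol_le g) a1)
  have b5 : ‖mulOp m0 (dirichletDeriv g)‖ ≤ A * ‖dirichletDeriv g‖ := (mulOp m0).le_opNorm _
  have b6 := norm_dirichletDeriv_le g
  refine ⟨g', fun x hx => (q1 hx).symm, ?_, ?_⟩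
  · calc ‖g'‖ ≤ ‖mulOp mv (hφ₂.toLp φ₂)‖ + ‖(2 : ℝ) • mulOp m1 (dirichletDeriv g)‖
          + ‖mulOp m0 g‖ := norm_add₃_le
      _ ≤ ‖dirichletDeriv g‖ * N + 2 * (A₁ * ‖dirichletDeriv g‖) + A * ‖g‖ := by
          rw [norm_smul, Real.norm_ofNat]
          gcongr
      _ ≤ 2 * ‖g‖ * N + 2 * (A₁ * (2 * ‖g‖)) + A * ‖g‖ := by gcongr
      _ ≤ (2 * N + 4 * A₁ + A + 1) * ‖g‖ := by linarith [norm_nonneg g]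
  · rw [hd]
    calc ‖mulOp m1 (dirichletSol g) + mulOp m0 (dirichletDeriv g)‖
        ≤ A₁ * ‖dirichletDeriv g‖ + A * ‖dirichletDeriv g‖ :=
          (norm_add_le _ _).trans (add_le_add b4 b5)
      _ ≤ (2 * N + 4 * A₁ + A + 1) * ‖dirichletDeriv g‖ := by
          have := mul_nonneg (show 0 ≤ 2 * N + 3 * A₁ + 1 by positivity)
            (norm_nonneg (dirichletDeriv g))
          linarith

lemma MemH2.exists_isPrim {u : ℝ → ℝ} (h : MemH2 u) :
    ∃ w w₁ w₂ : ℝ → ℝ, IsPrim w w₁ ∧ IsPrim w₁ w₂ ∧ MemLp w₂ 2 unitMeasure ∧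
      u =ᵐ[unitMeasure] w := by
  obtain ⟨hu, u₁, ⟨hu₁, u₂, hu₂, hd₁⟩, hd⟩ := h
  obtain ⟨w, hw, huw⟩ := hd.exists_isPrim (integrable_of_memLp hu) (integrable_of_memLp hu₁)
  obtain ⟨w₁, hw₁, huw₁⟩ := hd₁.exists_isPrim (integrable_of_memLp hu₁) (integrable_of_memLp hu₂)
  exact ⟨w, w₁, u₂, hw.congr (fun _ _ => rfl) huw₁.symm, hw₁, hu₂, huw⟩

lemma le_abs_of_ae_le_abs {u : ℝ → ℝ} (hu : ContinuousOn u (Icc 0 1)) {m : ℝ}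
    (h : ∀ᵐ x ∂unitMeasure, m ≤ |u x|) : ∀ x ∈ Icc (0 : ℝ) 1, m ≤ |u x| := by
  have h1 : EqOn (fun x => max (m - |u x|) 0) (fun _ => 0) (Icc (0 : ℝ) 1) := by
    refine Measure.eqOn_of_ae_eq (μ := volume) (s := Icc (0 : ℝ) 1) ?_ (by fun_prop)
      continuousOn_const (closure_interior_Icc zero_ne_one).symm.subset
    rw [← restrict_Ioo_eq_restrict_Icc]
    filter_upwards [h] with x hx
    exact max_eq_right (by linarith)
  intro x hx
  have h2 : max (m - |u x|) 0 = 0 := h1 hx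
  linarith [max_eq_right_iff.1 h2]

/-- The reciprocal of an `H²` function bounded away from zero is of class `H²`. -/
lemma IsPrim.exists_inv {u u₁ u₂ : ℝ → ℝ} (h₁ : IsPrim u u₁) (h₂ : IsPrim u₁ u₂)
    (hu₂ : MemLp u₂ 2 unitMeasure) (h0 : ∀ x ∈ Icc (0 : ℝ) 1, u x ≠ 0) :
    ∃ q₁ q₂ : ℝ → ℝ, IsPrim (fun x => (u x)⁻¹) q₁ ∧ IsPrim q₁ q₂ ∧ MemLp q₂ 2 unitMeasure := by
  have hq : ContinuousOn (fun x => (u x)⁻¹) (Icc 0 1) := h₁.continuousOn.inv₀ h0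
  have hc : ContinuousOn (fun x => -u₁ x * ((u x)⁻¹ * (u x)⁻¹)) (Icc 0 1) :=
    h₂.continuousOn.neg.mul (hq.mul hq)
  have p : IsPrim (fun x => (u x)⁻¹) (fun x => -u₁ x * ((u x)⁻¹ * (u x)⁻¹)) := by
    refine IsPrim.of_hasDerivAt hq (fun x hx => ?_) hc
    have e : -u₁ x * ((u x)⁻¹ * (u x)⁻¹) = -u₁ x / u x ^ 2 := by
      rw [div_eq_mul_inv, sq, mul_inv]
    rw [e]
    exact (h₁.hasDerivAt h₂.continuousOn hx).inv (h0 x (Ioo_subset_Icc_self hx))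
  refine ⟨_, _, p, h₂.neg.mul (p.mul p), MemLp.add ?_ (memLp_of_continuousOn ?_)⟩
  · exact MemLp.mul (p := 2) (q := ⊤) (memLp_top_of_continuousOn (hq.mul hq)) hu₂.neg
  · exact h₂.continuousOn.neg.mul ((hc.mul hq).add (hq.mul hc))

/-! ### Comparison with Fourier multipliers -/

lemma bracket_sq (ξ : ℝ) : bracket ξ ^ 2 = 1 + ξ ^ 2 := Real.sq_sqrt (by positivity)

lemma bracket_pow_four (ξ : ℝ) : bracket ξ ^ 4 = (1 + ξ ^ 2) ^ 2 := by
  rw [← bracket_sq]; ring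

lemma ratSymbol_eq (C ε lam d ξ : ℝ) : ratSymbol C ε lam d ξ
    = (C * (ε * bracket ξ ^ 4 + lam * bracket ξ ^ 2) + d) /
      (C * (ε * bracket ξ ^ 4 + lam * bracket ξ ^ 2) + d + 1) := by
  rw [ratSymbol, add_right_comm]

/-- The one-dimensional minimization behind all symbols `s / (s + 1)`: the right-hand side is
minimal at `b = a / (s + 1)`. -/
lemma div_add_one_mul_sq_le {s s' : ℝ} (hs : 0 ≤ s) (hss : s ≤ s') (a b : ℝ) :
    s / (s + 1) * a ^ 2 ≤ (a - b) ^ 2 + s' * b ^ 2 := by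
  have h1 : s * b ^ 2 ≤ s' * b ^ 2 := mul_le_mul_of_nonneg_right hss (sq_nonneg b)
  rw [div_mul_eq_mul_div, div_le_iff₀ (by linarith)]
  nlinarith [sq_nonneg (a - (s + 1) * b)]

lemma hasSum_norm_sub_sq (θ w : L2) :
    HasSum (fun k => (sineCoeff θ k - sineCoeff w k) ^ 2) (‖θ - w‖ ^ 2) := by
  refine (hasSum_sineCoeff_sq (θ - w)).congr_fun fun k => ?_
  rw [← inner_sineMode, ← inner_sineMode, ← inner_sineMode, inner_sub_right]

lemma hasSum_multiplierForm_ratSymbol {C ε lam d : ℝ} (hC : 0 ≤ C) (hε : 0 ≤ ε) (hlam : 0 ≤ lam)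
    (hd : 0 ≤ d) (θ : L2) :
    HasSum (fun k => ratSymbol C ε lam d (freq k) * sineCoeff θ k ^ 2)
      (multiplierForm (ratSymbol C ε lam d) θ) := by
  refine (summable_bdd_mul_sineCoeff_sq θ (B := 1) fun k => ?_).hasSum
  have h : 0 ≤ C * (ε * bracket (freq k) ^ 4 + lam * bracket (freq k) ^ 2) + d := by positivity
  rw [ratSymbol_eq, abs_of_nonneg (by positivity), div_le_one (by positivity)]
  linarith

/-- With `v` the solution of `v'' = g`, a quadratic form with constant coefficients in `v`, in
terms of the sine coefficients. -/
lemma hasSum_energy_const (a b c : ℝ) (g : L2) :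
    HasSum (fun k => (a * freq k ^ 4 + b * freq k ^ 2 + c) * sineCoeff (dirichletSol g) k ^ 2)
      (a * ‖g‖ ^ 2 + b * ‖dirichletDeriv g‖ ^ 2 + c * ‖dirichletSol g‖ ^ 2) := by
  refine ((((hasSum_norm_sq_dirichletSol g).mul_left a).add
    ((hasSum_norm_dirichletDeriv_sq g).mul_left b)).add
    ((hasSum_sineCoeff_sq (dirichletSol g)).mul_left c)).congr_fun fun k => ?_
  ring

lemma ae_lower_le_upper {r : ℝ → ℝ} {m M : ℝ}
    (h : ∀ᵐ x ∂unitMeasure, m ≤ |r x| ∧ |r x| ≤ M) : m ≤ M := by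
  obtain ⟨x, hx⟩ := h.exists
  exact hx.1.trans hx.2

lemma kappa_mul_norm_invSqrtOp_sq_le {C ε lam κ M : ℝ} (hC : 0 < C) (hε : 0 < ε) (hlam : 0 ≤ lam)
    (hκ : 0 < κ) (hM : 0 < M) (θ : L2) :
    κ * ‖invSqrtOp (C * M ^ 2 * ε) (C * M ^ 2 * lam) (κ + M ^ 2) θ‖ ^ 2
      ≤ multiplierForm (ratSymbol C ε lam (κ / M ^ 2)) θ := by
  refine hasSum_le (fun k => ?_) ((hasSum_norm_invSqrtOp_sq (by positivity) (by positivity)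
    (by positivity) θ).mul_left κ)
    (hasSum_multiplierForm_ratSymbol hC.le hε.le hlam (by positivity) θ)
  rw [← mul_div_assoc, mul_div_right_comm]
  refine mul_le_mul_of_nonneg_right ?_ (sq_nonneg _)
  set e₀ := C * (ε * freq k ^ 4 + lam * freq k ^ 2) with he₀
  set e := C * (ε * bracket (freq k) ^ 4 + lam * bracket (freq k) ^ 2) with he
  have h0 : 0 ≤ e₀ := by positivity
  have h1 : 0 ≤ e := by positivity
  have hd : 0 < κ / M ^ 2 := by positivity
  have e1 : κ / (C * M ^ 2 * ε * freq k ^ 4 + C * M ^ 2 * lam * freq k ^ 2 + (κ + M ^ 2))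
      = κ / M ^ 2 / (e₀ + (κ / M ^ 2 + 1)) := by
    rw [he₀]
    field_simp
  rw [e1, ratSymbol_eq, ← he, div_le_div_iff₀ (by positivity) (by positivity)]
  nlinarith [mul_nonneg h0 h1, mul_nonneg h0 hd.le, mul_nonneg h1 hd.le]

section

variable {ε lam κ : ℝ} {r : ℝ → ℝ} {m M : ℝ}

/-- The lower bound for `H²` weights: for the minimizer `v` of the energy functional, `w = r v`
has second and first derivatives bounded by those of `v`. -/
lemma exists_multiplierForm_le_hessianForm (hr : MemH2 r) (hrt : MemLp r ⊤ unitMeasure)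
    (hM0 : 0 < M) (hM : ∀ᵐ x ∂unitMeasure, |r x| ≤ M) :
    ∃ C : ℝ, 0 < C ∧ ∀ ε lam κ : ℝ, 0 < ε → 0 ≤ lam → 0 < κ → ∀ θ : L2,
      multiplierForm (ratSymbol C ε lam (κ / M ^ 2)) θ ≤ hessianForm ε lam κ r θ := by
  obtain ⟨R, R₁, R₂, hR, hR₁, hR₂, hrR⟩ := hr.exists_isPrim
  obtain ⟨K, hK, hmul⟩ := exists_dirichletSolFun_eq_mul hR hR₁ hR₂
  refine ⟨(4 * K ^ 2)⁻¹, by positivity, fun ε lam κ hε hlam hκ θ => ?_⟩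
  obtain ⟨g, hg⟩ := exists_hessianForm_eq hrt hε hlam hκ θ
  obtain ⟨g', hg', hK1, hK2⟩ := hmul g
  have hw : mulOp hrt (dirichletSol g) = dirichletSol g' := by
    apply Lp.ext
    filter_upwards [mulOp_ae hrt (dirichletSol g), dirichletSol_ae g, dirichletSol_ae g', hrR,
      ae_restrict_mem measurableSet_Ioo] with x h1 h2 h3 h4 h5
    rw [h1, h2, h3, h4, hg' x (Ioo_subset_Icc_self h5)]
  rw [hg, energyFunctional_eq, hw]
  have hMw : ‖dirichletSol g'‖ ≤ M * ‖dirichletSol g‖ := hw ▸ norm_mulOp_le hrt hM _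
  have b1 : ‖g'‖ ^ 2 / K ^ 2 ≤ ‖g‖ ^ 2 := by
    rw [div_le_iff₀ (by positivity), mul_comm, ← mul_pow]
    exact pow_le_pow_left₀ (norm_nonneg _) hK1 2
  have b2 : ‖dirichletDeriv g'‖ ^ 2 / K ^ 2 ≤ ‖dirichletDeriv g‖ ^ 2 := by
    rw [div_le_iff₀ (by positivity), mul_comm, ← mul_pow]
    exact pow_le_pow_left₀ (norm_nonneg _) hK2 2
  have b3 : ‖dirichletSol g'‖ ^ 2 / M ^ 2 ≤ ‖dirichletSol g‖ ^ 2 := by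
    rw [div_le_iff₀ (by positivity), mul_comm, ← mul_pow]
    exact pow_le_pow_left₀ (norm_nonneg _) hMw 2
  have main := hasSum_le (fun k => ?_)
    (hasSum_multiplierForm_ratSymbol (C := (4 * K ^ 2)⁻¹) (d := κ / M ^ 2) (by positivity) hε.le
      hlam (by positivity) θ)
    ((hasSum_norm_sub_sq θ (dirichletSol g')).add
      (hasSum_energy_const (ε / K ^ 2) (lam / K ^ 2) (κ / M ^ 2) g'))
  · calc _ ≤ _ := main
      _ = ‖θ - dirichletSol g'‖ ^ 2 + (ε * (‖g'‖ ^ 2 / K ^ 2)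
          + lam * (‖dirichletDeriv g'‖ ^ 2 / K ^ 2) + κ * (‖dirichletSol g'‖ ^ 2 / M ^ 2)) := by
        ring
      _ ≤ ‖θ - dirichletSol g'‖ ^ 2 + (ε * ‖g‖ ^ 2 + lam * ‖dirichletDeriv g‖ ^ 2
          + κ * ‖dirichletSol g‖ ^ 2) := by gcongr
      _ = _ := by ring
  · rw [ratSymbol_eq]
    refine div_add_one_mul_sq_le (by positivity) ?_ _ _
    rw [bracket_pow_four, bracket_sq]
    have hf := one_le_freq k
    -- `1 + ξ² ≤ 2 ξ²` for all frequencies, which accounts for the factor `4` in the constant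
    have h2 : 1 + freq k ^ 2 ≤ 2 * freq k ^ 2 := by nlinarith
    have h4 : (1 + freq k ^ 2) ^ 2 ≤ 4 * freq k ^ 4 := by
      calc (1 + freq k ^ 2) ^ 2 ≤ (2 * freq k ^ 2) ^ 2 := by gcongr
        _ = _ := by ring
    have h2' : 1 + freq k ^ 2 ≤ 4 * freq k ^ 2 := by nlinarith
    calc (4 * K ^ 2)⁻¹ * (ε * (1 + freq k ^ 2) ^ 2 + lam * (1 + freq k ^ 2)) + κ / M ^ 2
        ≤ (4 * K ^ 2)⁻¹ * (ε * (4 * freq k ^ 4) + lam * (4 * freq k ^ 2)) + κ / M ^ 2 := by gcongr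
      _ = _ := by field_simp

/-- The upper bound for `H²` weights: the energy functional is evaluated at `v = w / r`, where the
sine coefficients of `w` are optimal for the diagonal quadratic form that bounds it. -/
lemma exists_hessianForm_le_multiplierForm (hr : MemH2 r) (hrt : MemLp r ⊤ unitMeasure)
    (hm0 : 0 < m) (hm : ∀ᵐ x ∂unitMeasure, m ≤ |r x|) :
    ∃ C : ℝ, 0 < C ∧ ∀ ε lam κ : ℝ, 0 < ε → 0 ≤ lam → 0 < κ → ∀ θ : L2,
      hessianForm ε lam κ r θ ≤ multiplierForm (ratSymbol C ε lam (κ / m ^ 2)) θ := by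
  obtain ⟨R, R₁, R₂, hR, hR₁, hR₂, hrR⟩ := hr.exists_isPrim
  have hRm : ∀ x ∈ Icc (0 : ℝ) 1, m ≤ |R x| := by
    refine le_abs_of_ae_le_abs hR.continuousOn ?_
    filter_upwards [hm, hrR] with x h1 h2
    rwa [← h2]
  have hR0 : ∀ x ∈ Icc (0 : ℝ) 1, R x ≠ 0 := fun x hx =>
    abs_pos.1 (hm0.trans_le (hRm x hx))
  obtain ⟨q₁, q₂, hq, hq₁, hq₂⟩ := hR.exists_inv hR₁ hR₂ hR0
  obtain ⟨K, hK, hmul⟩ := exists_dirichletSolFun_eq_mul hq hq₁ hq₂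
  refine ⟨K ^ 2, by positivity, fun ε lam κ hε hlam hκ θ => ?_⟩
  -- the optimal `w` has the coefficients `θ̂ / (s + 1)`
  set s : ℕ → ℝ := fun k =>
    K ^ 2 * (ε * bracket (freq k) ^ 4 + lam * bracket (freq k) ^ 2) + κ / m ^ 2 with hs
  have hs0 : ∀ k, 0 ≤ s k := fun k => by positivity
  obtain ⟨f, hf⟩ := exists_dirichletSol_sineCoeff_eq θ (d := fun k => 1 / (s k + 1))
    (B := 1 / (K ^ 2 * ε)) (fun k => by
      have h1 := hs0 k
      rw [abs_of_nonneg (by positivity), mul_one_div, div_le_div_iff₀ (by positivity)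
        (by positivity), one_mul]
      have h2 : freq k ^ 2 ≤ bracket (freq k) ^ 4 := by
        rw [bracket_pow_four]; nlinarith [sq_nonneg (freq k), sq_nonneg (freq k ^ 2)]
      have h3 : 0 ≤ K ^ 2 * (lam * bracket (freq k) ^ 2) + κ / m ^ 2 + 1 := by positivity
      have h4 : freq k ^ 2 * (K ^ 2 * ε) ≤ bracket (freq k) ^ 4 * (K ^ 2 * ε) := by gcongr
      simp only [hs]
      linarith)
  obtain ⟨g, hg, hK1, hK2⟩ := hmul f
  have hw : mulOp hrt (dirichletSol g) = dirichletSol f := by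
    apply Lp.ext
    filter_upwards [mulOp_ae hrt (dirichletSol g), dirichletSol_ae g, dirichletSol_ae f, hrR,
      ae_restrict_mem measurableSet_Ioo] with x h1 h2 h3 h4 h5
    have h5' := Ioo_subset_Icc_self h5
    rw [h1, h2, h3, h4, hg x h5', mul_inv_cancel_left₀ (hR0 x h5')]
  refine (hessianForm_le hrt hε hlam hκ θ g).trans ?_
  rw [energyFunctional_eq, hw]
  have hmw : m * ‖dirichletSol g‖ ≤ ‖dirichletSol f‖ := hw ▸ le_norm_mulOp hrt hm0.le hm _
  have b1 : ‖g‖ ^ 2 ≤ K ^ 2 * ‖f‖ ^ 2 := by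
    rw [← mul_pow]
    exact pow_le_pow_left₀ (norm_nonneg _) hK1 2
  have b2 : ‖dirichletDeriv g‖ ^ 2 ≤ K ^ 2 * ‖dirichletDeriv f‖ ^ 2 := by
    rw [← mul_pow]
    exact pow_le_pow_left₀ (norm_nonneg _) hK2 2
  have b3 : ‖dirichletSol g‖ ^ 2 ≤ ‖dirichletSol f‖ ^ 2 / m ^ 2 := by
    rw [le_div_iff₀ (by positivity), mul_comm, ← mul_pow]
    exact pow_le_pow_left₀ (by positivity) hmw 2
  have main := hasSum_le (fun k => ?_)
    ((hasSum_norm_sub_sq θ (dirichletSol f)).add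
      (hasSum_energy_const (K ^ 2 * ε) (K ^ 2 * lam) (κ / m ^ 2) f))
    (hasSum_multiplierForm_ratSymbol (C := K ^ 2) (d := κ / m ^ 2) (by positivity) hε.le
      hlam (by positivity) θ)
  · calc _ ≤ ‖θ - dirichletSol f‖ ^ 2 + ε * (K ^ 2 * ‖f‖ ^ 2)
          + lam * (K ^ 2 * ‖dirichletDeriv f‖ ^ 2)
          + κ * (‖dirichletSol f‖ ^ 2 / m ^ 2) := by gcongr
      _ = ‖θ - dirichletSol f‖ ^ 2 + (K ^ 2 * ε * ‖f‖ ^ 2 + K ^ 2 * lam * ‖dirichletDeriv f‖ ^ 2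
          + κ / m ^ 2 * ‖dirichletSol f‖ ^ 2) := by ring
      _ ≤ _ := main
  · rw [ratSymbol_eq, hf]
    have hsk := hs0 k
    have h1 : K ^ 2 * ε * freq k ^ 4 + K ^ 2 * lam * freq k ^ 2 + κ / m ^ 2 ≤ s k := by
      simp only [hs]
      rw [bracket_pow_four, bracket_sq]
      have h4 : freq k ^ 4 ≤ (1 + freq k ^ 2) ^ 2 := by nlinarith [sq_nonneg (freq k)]
      have h2 : freq k ^ 2 ≤ 1 + freq k ^ 2 := by linarith
      calc K ^ 2 * ε * freq k ^ 4 + K ^ 2 * lam * freq k ^ 2 + κ / m ^ 2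
          = K ^ 2 * (ε * freq k ^ 4 + lam * freq k ^ 2) + κ / m ^ 2 := by ring
        _ ≤ _ := by gcongr
    calc (sineCoeff θ k - 1 / (s k + 1) * sineCoeff θ k) ^ 2
          + (K ^ 2 * ε * freq k ^ 4 + K ^ 2 * lam * freq k ^ 2 + κ / m ^ 2)
            * (1 / (s k + 1) * sineCoeff θ k) ^ 2
        ≤ (sineCoeff θ k - 1 / (s k + 1) * sineCoeff θ k) ^ 2
          + s k * (1 / (s k + 1) * sineCoeff θ k) ^ 2 := by gcongr
      _ = s k / (s k + 1) * sineCoeff θ k ^ 2 := by field_simp; ring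

/-- The lower bound for weights that are merely bounded: already the terms `‖θ - r v‖²` and
`κ ‖v‖²` of the energy functional suffice. -/
lemma kappa_mul_norm_invSqrtOp_sq_le_hessianForm (hrt : MemLp r ⊤ unitMeasure) (hM0 : 0 < M)
    (hM : ∀ᵐ x ∂unitMeasure, |r x| ≤ M) (hε : 0 < ε) (hlam : 0 ≤ lam) (hκ : 0 < κ) {b : ℝ}
    (hb : 0 ≤ b) (θ : L2) :
    κ * ‖invSqrtOp 0 b (κ + M ^ 2) θ‖ ^ 2 ≤ hessianForm ε lam κ r θ := by
  obtain ⟨g, hg⟩ := exists_hessianForm_eq hrt hε hlam hκ θ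
  rw [hg, energyFunctional_eq]
  set w := mulOp hrt (dirichletSol g) with hw
  have b3 : ‖w‖ ^ 2 / M ^ 2 ≤ ‖dirichletSol g‖ ^ 2 := by
    rw [div_le_iff₀ (by positivity), mul_comm, ← mul_pow]
    exact pow_le_pow_left₀ (norm_nonneg _) (norm_mulOp_le hrt hM _) 2
  have main := hasSum_le (fun k => ?_)
    ((hasSum_norm_invSqrtOp_sq le_rfl hb (by positivity : 0 < κ + M ^ 2) θ).mul_left κ)
    ((hasSum_norm_sub_sq θ w).add ((hasSum_sineCoeff_sq w).mul_left (κ / M ^ 2)))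
  · calc _ ≤ _ := main
      _ = ‖θ - w‖ ^ 2 + κ * (‖w‖ ^ 2 / M ^ 2) := by ring
      _ ≤ ‖θ - w‖ ^ 2 + κ * ‖dirichletSol g‖ ^ 2 := by gcongr
      _ ≤ _ := by
        have : 0 ≤ ε * ‖g‖ ^ 2 + lam * ‖dirichletDeriv g‖ ^ 2 := by positivity
        linarith
  · refine le_trans ?_ (div_add_one_mul_sq_le (s := κ / M ^ 2) (by positivity) le_rfl _ _)
    rw [← mul_div_assoc, mul_div_right_comm]
    refine mul_le_mul_of_nonneg_right ?_ (sq_nonneg _)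
    have e1 : κ / M ^ 2 / (κ / M ^ 2 + 1) = κ / (κ + M ^ 2) := by field_simp
    rw [e1]
    refine div_le_div_of_nonneg_left hκ.le (by positivity) ?_
    have : 0 ≤ b * freq k ^ 2 := by positivity
    linarith

/-- Replacing `r²` by its upper bound in the energy functional. -/
lemma hessianForm_le_sub_norm_invSqrtOp_sq (hrt : MemLp r ⊤ unitMeasure)
    (hM : ∀ᵐ x ∂unitMeasure, |r x| ≤ M) (hε : 0 < ε) (hlam : 0 ≤ lam) (hκ : 0 < κ) (θ : L2) :
    hessianForm ε lam κ r θ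
      ≤ ‖θ‖ ^ 2 - ‖invSqrtOp ε lam (κ + M ^ 2) (fun x => θ x * r x)‖ ^ 2 := by
  have hF : (fun x => θ x * r x) =ᵐ[unitMeasure] mulOp hrt θ := by
    filter_upwards [mulOp_ae hrt θ] with x hx
    rw [hx, mul_comm]
  rw [invSqrtOp_congr hF]
  set F := mulOp hrt θ with hFdef
  set p : ℕ → ℝ := fun k => ε * freq k ^ 4 + lam * freq k ^ 2 + (κ + M ^ 2) with hp
  have hp0 : ∀ k, 0 < p k := fun k => by positivity
  -- the minimizer for the constant weight `M`
  obtain ⟨g, hg⟩ := exists_dirichletSol_sineCoeff_eq F (d := fun k => 1 / p k) (B := 1 / ε)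
    (fun k => by
      have h1 := hp0 k
      rw [abs_of_nonneg (by positivity), mul_one_div, div_le_div_iff₀ h1 hε, one_mul]
      have h2 : freq k ^ 2 ≤ freq k ^ 4 := pow_le_pow_right₀ (one_le_freq k) (by norm_num)
      have h3 : freq k ^ 2 * ε ≤ freq k ^ 4 * ε := by gcongr
      have h4 : 0 ≤ lam * freq k ^ 2 + (κ + M ^ 2) := by positivity
      simp only [hp]
      linarith)
  refine (hessianForm_le hrt hε hlam hκ θ g).trans ?_
  have h1 : ‖mulOp hrt (dirichletSol g)‖ ^ 2 ≤ M ^ 2 * ‖dirichletSol g‖ ^ 2 := by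
    rw [← mul_pow]
    exact pow_le_pow_left₀ (norm_nonneg _) (norm_mulOp_le hrt hM _) 2
  have h2 := (((hasSum_sineCoeff_mul F (dirichletSol g)).mul_left 2).sub
    (hasSum_energy_const ε lam (κ + M ^ 2) g))
  have h3 := hasSum_norm_invSqrtOp_sq hε.le hlam (by positivity : 0 < κ + M ^ 2) F
  have h4 := h2.unique (h3.congr_fun fun k => ?_)
  · rw [energy_self, ← h4]
    linarith
  · have h5 := (hp0 k).ne'
    rw [hg]
    simp only [hp] at h5 ⊢
    field_simp
    ring

/-- Replacing `r²` by its lower bound in the energy functional. -/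
lemma sub_norm_invSqrtOp_sq_le_hessianForm (hrt : MemLp r ⊤ unitMeasure) (hm0 : 0 ≤ m)
    (hm : ∀ᵐ x ∂unitMeasure, m ≤ |r x|) (hε : 0 < ε) (hlam : 0 ≤ lam) (hκ : 0 < κ) (θ : L2) :
    ‖θ‖ ^ 2 - ‖invSqrtOp ε lam (κ + m ^ 2) (fun x => θ x * r x)‖ ^ 2
      ≤ hessianForm ε lam κ r θ := by
  have hF : (fun x => θ x * r x) =ᵐ[unitMeasure] mulOp hrt θ := by
    filter_upwards [mulOp_ae hrt θ] with x hx
    rw [hx, mul_comm]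
  rw [invSqrtOp_congr hF]
  obtain ⟨g, hg⟩ := exists_hessianForm_eq hrt hε hlam hκ θ
  rw [hg]
  set F := mulOp hrt θ with hFdef
  have h1 : m ^ 2 * ‖dirichletSol g‖ ^ 2 ≤ ‖mulOp hrt (dirichletSol g)‖ ^ 2 := by
    rw [← mul_pow]
    exact pow_le_pow_left₀ (by positivity) (le_norm_mulOp hrt hm0 hm _) 2
  have h2 := (((hasSum_sineCoeff_mul F (dirichletSol g)).mul_left 2).sub
    (hasSum_energy_const ε lam (κ + m ^ 2) g))
  have h3 := hasSum_norm_invSqrtOp_sq hε.le hlam (by positivity : 0 < κ + m ^ 2) F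
  have h4 := hasSum_le (fun k => ?_) h2 h3
  · rw [energy_self]
    linarith
  · have hp : 0 < ε * freq k ^ 4 + lam * freq k ^ 2 + (κ + m ^ 2) := by positivity
    rw [le_div_iff₀ hp]
    -- the difference is the square of `F̂ - p v̂`, with `p` the symbol
    nlinarith [sq_nonneg (sineCoeff F k - (ε * freq k ^ 4 + lam * freq k ^ 2 + (κ + m ^ 2))
      * sineCoeff (dirichletSol g) k)]

end

end HVHessian

end

theorem mainTheorem6 (ρ ρx : ℝ → ℝ)
    (hρ : MeasureTheory.MemLp ρ 2 HVHessian.unitMeasure)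
    (hρx : HVHessian.HasWeakDeriv ρ ρx) (m M : ℝ) :
    -- `L` is invertible, so that `B⁻¹` is well defined
    (MeasureTheory.MemLp ρx 2 HVHessian.unitMeasure →
      (∀ᵐ x ∂HVHessian.unitMeasure, |ρx x| ≤ M) →
      ∀ ε lam κ : ℝ, 0 < ε → 0 ≤ lam → 0 < κ → ∀ f : HVHessian.L2,
        ∃ v : ℝ → ℝ, HVHessian.IsWeakSol ε lam κ ρx f v ∧
          ∀ w : ℝ → ℝ, HVHessian.IsWeakSol ε lam κ ρx f w → Set.EqOn w v (Set.Icc 0 1)) ∧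
    -- (i)
    (HVHessian.MemH2 ρx → 0 < m →
      (∀ᵐ x ∂HVHessian.unitMeasure, m ≤ |ρx x| ∧ |ρx x| ≤ M) →
      ∃ C₁ C₂ : ℝ, 0 < C₁ ∧ 0 < C₂ ∧
        ∀ ε lam κ : ℝ, 0 < ε → 0 ≤ lam → 0 < κ → ∀ θ : HVHessian.L2,
          κ * ‖HVHessian.invSqrtOp (C₁ * M ^ 2 * ε) (C₁ * M ^ 2 * lam) (κ + M ^ 2) θ‖ ^ 2
            ≤ HVHessian.multiplierForm (HVHessian.ratSymbol C₁ ε lam (κ / M ^ 2)) θ ∧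
          HVHessian.multiplierForm (HVHessian.ratSymbol C₁ ε lam (κ / M ^ 2)) θ
            ≤ HVHessian.hessianForm ε lam κ ρx θ ∧
          HVHessian.hessianForm ε lam κ ρx θ
            ≤ HVHessian.multiplierForm (HVHessian.ratSymbol C₂ ε lam (κ / m ^ 2)) θ) ∧
    -- (ii)
    (HVHessian.MemH1 ρx → 0 < m →
      (∀ᵐ x ∂HVHessian.unitMeasure, m ≤ |ρx x| ∧ |ρx x| ≤ M) →
      ∃ C₃ : ℝ, 0 < C₃ ∧
        ∀ ε lam κ : ℝ, 0 < ε → 0 ≤ lam → 0 < κ → ∀ θ : HVHessian.L2,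
          κ * ‖HVHessian.invSqrtOp 0 (M ^ 2 * ε / C₃) (κ + M ^ 2) θ‖ ^ 2
            ≤ HVHessian.hessianForm ε lam κ ρx θ ∧
          HVHessian.hessianForm ε lam κ ρx θ
            ≤ ‖θ‖ ^ 2 - ‖HVHessian.invSqrtOp ε lam (κ + M ^ 2) (fun x => θ x * ρx x)‖ ^ 2) ∧
    -- (iii)
    (MeasureTheory.MemLp ρx 2 HVHessian.unitMeasure → 0 ≤ m →
      (∀ᵐ x ∂HVHessian.unitMeasure, m ≤ |ρx x| ∧ |ρx x| ≤ M) →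
      ∀ ε lam κ : ℝ, 0 < ε → 0 ≤ lam → 0 < κ → ∀ θ : HVHessian.L2,
        ‖θ‖ ^ 2 - ‖HVHessian.invSqrtOp ε lam (κ + m ^ 2) (fun x => θ x * ρx x)‖ ^ 2
          ≤ HVHessian.hessianForm ε lam κ ρx θ ∧
        HVHessian.hessianForm ε lam κ ρx θ
          ≤ ‖θ‖ ^ 2 - ‖HVHessian.invSqrtOp ε lam (κ + M ^ 2) (fun x => θ x * ρx x)‖ ^ 2) := by
  have bdd : MemLp ρx 2 HVHessian.unitMeasure → (∀ᵐ x ∂HVHessian.unitMeasure, |ρx x| ≤ M) →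
      MemLp ρx ⊤ HVHessian.unitMeasure := fun h hM => memLp_top_of_bound h.1 M hM
  refine ⟨?_, ?_, ?_, ?_⟩
  · intro h2 hM ε lam κ hε hlam hκ f
    exact HVHessian.exists_unique_isWeakSol (bdd h2 hM) hε hlam hκ f
  · intro hH hm h
    have hM := h.mono fun x hx => hx.2
    have hM0 : 0 < M := hm.trans_le (HVHessian.ae_lower_le_upper h)
    have hrt := bdd hH.1 hM
    obtain ⟨C₁, hC₁, h1⟩ := HVHessian.exists_multiplierForm_le_hessianForm hH hrt hM0 hM
    obtain ⟨C₂, hC₂, h2⟩ := HVHessian.exists_hessianForm_le_multiplierForm hH hrt hm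
      (h.mono fun x hx => hx.1)
    exact ⟨C₁, C₂, hC₁, hC₂, fun ε lam κ hε hlam hκ θ =>
      ⟨HVHessian.kappa_mul_norm_invSqrtOp_sq_le hC₁ hε hlam hκ hM0 θ,
        h1 ε lam κ hε hlam hκ θ, h2 ε lam κ hε hlam hκ θ⟩⟩
  · intro hH hm h
    have hM := h.mono fun x hx => hx.2
    have hM0 : 0 < M := hm.trans_le (HVHessian.ae_lower_le_upper h)
    have hrt := bdd hH.1 hM
    exact ⟨1, one_pos, fun ε lam κ hε hlam hκ θ =>
      ⟨HVHessian.kappa_mul_norm_invSqrtOp_sq_le_hessianForm hrt hM0 hM hε hlam hκ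
        (by positivity) θ,
        HVHessian.hessianForm_le_sub_norm_invSqrtOp_sq hrt hM hε hlam hκ θ⟩⟩
  · intro h2 hm h ε lam κ hε hlam hκ θ
    have hM := h.mono fun x hx => hx.2
    exact ⟨HVHessian.sub_norm_invSqrtOp_sq_le_hessianForm (bdd h2 hM) hm
        (h.mono fun x hx => hx.1) hε hlam hκ θ,
      HVHessian.hessianForm_le_sub_norm_invSqrtOp_sq (bdd h2 hM) hM hε hlam hκ θ⟩
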